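/- **Corollary 4.8.** Let $(\Gamma,m,f)$ be a Dyer graph: $\Gamma$ is a finite simple graph with vertex set $V$, $f\colon V\to\mathbb{N}_{\ge 2}\cup\{\infty\}$, $m\colon E(\Gamma)\to\mathbb{N}_{\ge 2}$, and for every edge $e=\{x,y\}$ with $m(e)\neq 2$ one has $f(x)=f(y)=2$. Let $$D=\langle V\mid x^{f(x)}=1 \text{ if } f(x)\ne\infty,\ \underbrace{xyxy\cdots}_{m(\{x,y\})}=\underbrace{yxyx\cdots}_{m(\{x,y\})}\text{ if }\{x,y\}\in E(\Gamma)\rangle$$ be the associated Dyer group. For $Y\subseteq V$ let $D_Y$ be the subgroup of $D$ generated by $Y$. For a group $G$ with finite generating set $S$ and $A\subseteq G$ let $\mathcal{G}_{(A,S)}(t)=\sum_{g\in A}t^{l_S(g)}$, where $l_S$ is the word length with respect to $S\cup S^{-1}$. Put $V_2=\{x\in V: f(x)=2\}$, $V_p=\{x\in V: 2<f(x)<\infty\}$, $V_\infty=\{x\in V: f(x)=\infty\}$, $D_2=D_{V_2}$. The group $D$ is of spherical type if $\Gamma$ is complete and $D_2$ is finite. 1. If $D$ is not of spherical type, then $$\frac{(-1)^{|V|+1}}{\mathcal{G}_{(D,V)}(t)}=\sum_{Y\subsetneq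 V}\frac{(-1)^{|Y|}}{\mathcal{G}_{(D_Y,Y)}(t)}.$$ 2. If $D$ is of spherical type, let $l=|V_\infty|$, let $m$ be the maximal length of an element of $D_2$ with respect to $V_2$, and for $x\in V_p$ let $P_x(t)=2t+2t^2+\dots+2t^{r-1}+t^r$ if $f(x)=2r$ and $P_x(t)=2t+2t^2+\dots+2t^r$ if $f(x)=2r+1$. Put $$P_D(t)=t^m\Big(\prod_{x\in V_p}P_x(t)\Big)\Big(\frac{2t}{1-t}\Big)^l.$$ Then $$\frac{P_D(t)+(-1)^{|V|+1}}{\mathcal{G}_{(D,V)}(t)}=\sum_{Y\subsetneq V}\frac{(-1)^{|Y|}}{\mathcal{G}_{(D_Y,Y)}(t)}.$$ Moreover, let the syllable length $l_{sy}(g)$ be the least $n$ such that $g=s_1^{a_1}\cdots s_n^{a_n}$ with $s_i\in V$, $a_i\in\mathbb{Z}$; for $X\subseteq V$ let $A_X$ be the set of $g\in D$ with $l_{sy}(g)\le l_{sy}(gh)$ for all $h\in D_X$, and let $B_\emptyset=A_\emptyset\setminus\bigcup_{\emptyset\subsetneq Y\subseteq V}A_Y$. Then $\mathcal{G}_{(B_\emptyset,V)}(t)=P_D(t)$,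 and if $V_p=\{x_1,\dots,x_k\}$ and $V_\infty=\{y_1,\dots,y_l\}$ (without repetitions), then $B_\emptyset$ is exactly the set of elements $$w_0x_1^{a_1}\cdots x_k^{a_k}y_1^{b_1}\cdots y_l^{b_l}$$ where $w_0\in D_2$ is the longest element of $D_2$, that is, $l_{V_2}(w_0s)<l_{V_2}(w_0)$ for all $s\in V_2$, the $a_i$ are integers with $f(x_i)\nmid a_i$, and the $b_j$ are nonzero integers. All identities are between formal power series in $t$. -/

import Mathlib

noncomputable section

/-! ### Word length, syllable length and growth series in a group -/

/-- The word length `l_S(g)`: the least `n` such that `g` is a product of `n` elements of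
`S ∪ S⁻¹` (where `S` generates the group). -/
def wordLength {G : Type*} [Group G] (S : Set G) (g : G) : ℕ :=
  sInf {n | ∃ w : List G, w.length = n ∧ (∀ s ∈ w, s ∈ S ∨ s⁻¹ ∈ S) ∧ w.prod = g}

/-- The syllable length `l_sy(g)`: the least `n` such that `g = s₁ ^ a₁ * ⋯ * sₙ ^ aₙ` with
`sᵢ ∈ S` and `aᵢ ∈ ℤ` (where `S` generates the group). -/
def syllableLength {G : Type*} [Group G] (S : Set G) (g : G) : ℕ :=
  sInf {n | ∃ w : List (G × ℤ), w.length = n ∧ (∀ p ∈ w, p.1 ∈ S) ∧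
    (w.map fun p => p.1 ^ p.2).prod = g}

/-- The growth series `∑_{g ∈ A} t ^ l_S(g)` of a subset `A` of a group with finite generating
set `S`. The coefficients are integers; they are regarded as rational numbers so that
`⁻¹` is available (it is the true inverse for series with nonzero constant term). -/
def growthSeriesOn {G : Type*} [Group G] (S A : Set G) : PowerSeries ℚ :=
  PowerSeries.mk fun n => (({g | g ∈ A ∧ wordLength S g = n} : Set G).ncard : ℚ)

/-- The growth series of a group with respect to a finite generating set `S`. -/
def growthSeries {G : Type*} [Group G] (S : Set G) : PowerSeries ℚ :=
  growthSeriesOn S Set.univ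

/-- `w` is a longest element with respect to `S`: `l(w s) < l(w)` for all `s ∈ S`. -/
def IsLongestElement {G : Type*} [Group G] (S : Set G) (w : G) : Prop :=
  ∀ s ∈ S, wordLength S (w * s) < wordLength S w

/-- The alternating product `π(a, b, n) = a b a b ⋯` with `n` factors. -/
def altProd {G : Type*} [Group G] : G → G → ℕ → G
  | _, _, 0 => 1
  | a, b, n + 1 => a * altProd b a n

/-! ### Dyer graphs and Dyer groups -/

/-- A Dyer graph on the vertex set `V`. Only the values of `m` on the edges matter. -/
structure DyerGraph (V : Type*) where
  /-- The underlying simple graph. -/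
  graph : SimpleGraph V
  /-- The vertex labels, with values in `{2, 3, …} ∪ {∞}`. -/
  f : V → ℕ∞
  /-- The edge labels, with values in `{2, 3, …}`. -/
  m : Sym2 V → ℕ
  two_le_f : ∀ x, 2 ≤ f x
  two_le_m : ∀ x y, graph.Adj x y → 2 ≤ m s(x, y)
  f_eq_two : ∀ x y, graph.Adj x y → m s(x, y) ≠ 2 → f x = 2 ∧ f y = 2

namespace DyerGraph

variable {V : Type*} (Δ : DyerGraph V)

/-- The relators `x ^ f(x)` for `f(x) ≠ ∞`, and `π(x, y, m) * π(y, x, m)⁻¹` for every edge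
`{x, y}` with label `m`. -/
def relators : Set (FreeGroup V) :=
  {r | ∃ x, Δ.f x ≠ ⊤ ∧ r = FreeGroup.of x ^ (Δ.f x).toNat} ∪
  {r | ∃ x y, Δ.graph.Adj x y ∧
    r = altProd (FreeGroup.of x) (FreeGroup.of y) (Δ.m s(x, y)) *
      (altProd (FreeGroup.of y) (FreeGroup.of x) (Δ.m s(x, y)))⁻¹}

/-- The Dyer group `D` of the Dyer graph. -/
abbrev DyerGroup : Type _ := PresentedGroup Δ.relators

/-- The generator of `D` given by a vertex. -/
def gen (x : V) : Δ.DyerGroup := PresentedGroup.of x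

/-- The standard generating set `V` of `D`. -/
def gens : Set Δ.DyerGroup := Set.range Δ.gen

/-- The standard parabolic subgroup `D_Y` generated by `Y ⊆ V`. -/
def parabolic (Y : Set V) : Subgroup Δ.DyerGroup := Subgroup.closure (Δ.gen '' Y)

/-- The standard generating set `Y` of `D_Y`, as a subset of the group `D_Y`. -/
def parabolicGens (Y : Set V) : Set (Δ.parabolic Y) := {g | (g : Δ.DyerGroup) ∈ Δ.gen '' Y}

/-- `V_2`, the vertices with label `2`. -/
def V2 : Set V := {x | Δ.f x = 2}

/-- `V_p`, the vertices with label strictly between `2` and `∞`. -/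
def Vp : Set V := {x | 2 < Δ.f x ∧ Δ.f x < ⊤}

/-- `V_∞`, the vertices with label `∞`. -/
def Vinf : Set V := {x | Δ.f x = ⊤}

/-- `D` is of spherical type: the graph is complete and `D_2` is finite. -/
def IsSpherical : Prop := Δ.graph = ⊤ ∧ Finite (Δ.parabolic Δ.V2)

/-- `g` is `X`-minimal: it has the least syllable length in the coset `g D_X`. -/
def IsMinimal (X : Set V) (g : Δ.DyerGroup) : Prop :=
  ∀ h ∈ Δ.parabolic X, syllableLength Δ.gens g ≤ syllableLength Δ.gens (g * h)

/-- `A_X`, the set of `X`-minimal elements. -/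
def A (X : Set V) : Set Δ.DyerGroup := {g | Δ.IsMinimal X g}

/-- `B_X = A_X - ⋃_{X ⊊ Y} A_Y`. -/
def B (X : Set V) : Set Δ.DyerGroup := Δ.A X \ ⋃ (Y : Set V) (_ : X ⊂ Y), Δ.A Y

/-- `P_x(t)` for `x ∈ V_p`: it is `2t + ⋯ + 2t^(r-1) + t^r` if `f(x) = 2r`, and
`2t + ⋯ + 2t^r` if `f(x) = 2r + 1`. -/
def Px (x : V) : PowerSeries ℚ :=
  let n := (Δ.f x).toNat
  if Even n then ∑ i ∈ Finset.Ico 1 (n / 2), 2 * PowerSeries.X ^ i + PowerSeries.X ^ (n / 2)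
  else ∑ i ∈ Finset.Icc 1 (n / 2), 2 * PowerSeries.X ^ i

/-- The maximal length of an element of `D_2` with respect to `V_2` (for `D_2` finite). -/
def maxLength : ℕ := ⨆ g : Δ.parabolic Δ.V2, wordLength (Δ.parabolicGens Δ.V2) g

open Classical in
/-- `P_D(t) = t^m (∏_{x ∈ V_p} P_x(t)) (2t / (1 - t))^l`, with `m` the maximal length in `D_2`
and `l = |V_∞|`. -/
def PD [Fintype V] : PowerSeries ℚ :=
  PowerSeries.X ^ Δ.maxLength * (∏ x ∈ Finset.univ.filter (fun x => x ∈ Δ.Vp), Δ.Px x) *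
    (2 * PowerSeries.X * (1 - PowerSeries.X)⁻¹) ^ Δ.Vinf.ncard

end DyerGraph

end

/-!
The proof rests on a cocycle that records right inversions. Let `D` act on `D × Coeff`, where a
generator `x` of order `n` conjugates the first component and adds an element `theta n` of order
`n` to the second one whenever the first is `x` itself; the defining relations hold for this action
(`inversionHom`). It yields `inversion g t`, with
`inversion (g h) t = inversion h t + inversion g (h t h⁻¹)`. An inversion `t` of a product of
syllables comes from one of the syllables, and multiplying by a power of `t` deletes that syllable
(`exists_split`, `exists_zpow_lt`). Hence a product of nontrivial syllables is shortest exactly if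
its inversions are distinct, and both the syllable length and the word length of `g` are sums over
the inversions of `g` (`syllableLength_eq`, `wordLength_parabolicGens`). An `X`-minimal element has
no inversion in `D_X`, so lengths are additive on `A_X · D_X`, every `g` is uniquely of this form, and
`g` is `X`-minimal iff no vertex of `X` is an inversion of `g` (`norm_mul_of_isMinimal`,
`eq_of_isMinimal_mul_eq`, `isMinimal_iff_forall`). Thus the growth series of `D` is the product of
those of `A_X` and `D_X`, and `A_X` is the intersection of the sets `A_{x}`, so that
inclusion-exclusion over the subsets of `V` gives
`∑ Y, (-1) ^ |Y| / 𝒢(D_Y) = 𝒢(B_∅) / 𝒢(D)` (`sum_ssubsets_eq`).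

It remains to determine `B_∅`, the set of elements that have all vertices as inversions.

* Two vertices that are inversions of the same element are adjacent (`adj_of_inversion_ne_zero`).
  Otherwise some element of `D_{x, y}` would have shortest words that begin with different letters.
  This is excluded by ping-pong in a representation by complex reflections, in which the form takes
  an indeterminate as its value on nonadjacent vertices and degrees of polynomials measure dominance.
  So `Γ` is complete, the generators outside `V_2` are central, and `g = w ∏ x ^ c x` with
  `w ∈ D_2` (`mem_B_empty_iff_exists`).
* An element `w` of `D_2` that has all of `V_2` as inversions is strictly longer than every other
  element of `D_2` (`eq_or_wordNorm_lt`). This uses the Demazure operators `g ↦ max (g, s g)` and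
  `g ↦ max (g, g t)`, which commute: if `w` is obtained from `1` by left operators and `u` by right
  operators, then `w` is also obtained from `u` by left operators, none of which shortens.
  Therefore `D_2` is finite and `w` is its unique longest element (`isSpherical_of_mem_B`,
  `exists_longest`).

In spherical type, adjoining the central cyclic factors one at a time multiplies the growth series
by the series of the nonzero residues modulo `f x`, or of the nonzero integers
(`countSeries_powProdSet`).
-/

/-! ### Homomorphisms out of a Dyer group -/

theorem altProd_mul_inv_eq_pow {G : Type*} [Group G] {a b : G} (ha : a * a = 1) (hb : b * b = 1)
    (n : ℕ) : altProd a b n * (altProd b a n)⁻¹ = (a * b) ^ n := by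
  have key : ∀ n : ℕ, altProd a b n * (altProd b a n)⁻¹ = (a * b) ^ n ∧
      altProd b a n * (altProd a b n)⁻¹ = (b * a) ^ n := by
    intro n
    induction n with
    | zero => simp [altProd]
    | succ n ih =>
      have ha' : a⁻¹ = a := inv_eq_of_mul_eq_one_left ha
      have hb' : b⁻¹ = b := inv_eq_of_mul_eq_one_left hb
      have comm : ∀ c d : G, c * (d * c) ^ n * d = (c * d) ^ (n + 1) := by
        intro c d
        rw [← mul_pow_mul, pow_succ]
        simp [mul_assoc]
      constructor
      · calc _ = a * (altProd b a n * (altProd a b n)⁻¹) * b⁻¹ := by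
              simp only [altProd]; group
          _ = _ := by rw [ih.2, hb', comm]
      · calc _ = b * (altProd a b n * (altProd b a n)⁻¹) * a⁻¹ := by
              simp only [altProd]; group
          _ = _ := by rw [ih.1, ha', comm]
  exact (key n).1

theorem map_altProd {G H : Type*} [Group G] [Group H] (φ : G →* H) (a b : G) (n : ℕ) :
    φ (altProd a b n) = altProd (φ a) (φ b) n := by
  induction n generalizing a b with
  | zero => simp [altProd]
  | succ n ih => simp [altProd, ih]

namespace DyerGraph

variable {V : Type*} (Δ : DyerGraph V)

/-- The order of the generator `x`, with the convention that `0` stands for infinite order. -/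
def ord (x : V) : ℕ := (Δ.f x).toNat

theorem ord_ne_one (x : V) : Δ.ord x ≠ 1 := by
  intro h
  have h2 := Δ.two_le_f x
  rcases eq_or_ne (Δ.f x) ⊤ with ht | ht
  · simp [ord, ht] at h
  · have h1 : Δ.f x = ((1 : ℕ) : ℕ∞) := by rw [← h]; exact (ENat.natCast_toNat ht).symm
    rw [h1] at h2
    exact absurd (ENat.natCast_le_natCast.mp h2 : 2 ≤ 1) (by norm_num)

theorem ord_eq_two_iff {x : V} : Δ.ord x = 2 ↔ x ∈ Δ.V2 := by
  simp only [ord, V2, Set.mem_ofPred_eq]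
  constructor
  · intro h
    have ht : Δ.f x ≠ ⊤ := by rintro ht; simp [ht] at h
    rw [← ENat.natCast_toNat ht, h]; rfl
  · intro h; rw [h]; rfl

theorem ord_eq_zero_iff {x : V} : Δ.ord x = 0 ↔ Δ.f x = ⊤ := by
  have h2 := Δ.two_le_f x
  rw [ord, ENat.toNat_eq_zero]
  constructor
  · rintro (h | h)
    · simp [h] at h2
    · exact h
  · exact Or.inr

theorem gen_pow_ord (x : V) : Δ.gen x ^ Δ.ord x = 1 := by
  by_cases h : Δ.f x = ⊤
  · rw [(Δ.ord_eq_zero_iff).2 h, pow_zero]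
  · have := PresentedGroup.one_of_mem (rels := Δ.relators)
      (x := FreeGroup.of x ^ (Δ.f x).toNat) (Or.inl ⟨x, h, rfl⟩)
    rw [map_pow] at this
    exact this

theorem altProd_gen {x y : V} (h : Δ.graph.Adj x y) :
    altProd (Δ.gen x) (Δ.gen y) (Δ.m s(x, y)) = altProd (Δ.gen y) (Δ.gen x) (Δ.m s(x, y)) := by
  have := PresentedGroup.one_of_mem (rels := Δ.relators) (Or.inr ⟨x, y, h, rfl⟩)
  rw [map_mul, map_inv, map_altProd, map_altProd] at this
  exact mul_inv_eq_one.1 this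

theorem gen_mul_self {x : V} (hx : x ∈ Δ.V2) : Δ.gen x * Δ.gen x = 1 := by
  have := Δ.gen_pow_ord x
  rwa [(Δ.ord_eq_two_iff).2 hx, pow_two] at this

theorem gen_inv {x : V} (hx : x ∈ Δ.V2) : (Δ.gen x)⁻¹ = Δ.gen x :=
  inv_eq_of_mul_eq_one_left (Δ.gen_mul_self hx)

theorem mul_gen_pow_m {x y : V} (h : Δ.graph.Adj x y) (hx : x ∈ Δ.V2) (hy : y ∈ Δ.V2) :
    (Δ.gen x * Δ.gen y) ^ Δ.m s(x, y) = 1 := by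
  rw [← altProd_mul_inv_eq_pow (Δ.gen_mul_self hx) (Δ.gen_mul_self hy), Δ.altProd_gen h,
    mul_inv_cancel]

theorem commute_gen {x y : V} (h : Δ.graph.Adj x y) (hm : Δ.m s(x, y) = 2) :
    Commute (Δ.gen x) (Δ.gen y) := by
  have := Δ.altProd_gen h
  rw [hm] at this
  simpa [altProd, Commute, SemiconjBy] using this

theorem m_eq_two_of_notMem {x y : V} (h : Δ.graph.Adj x y) (hx : x ∉ Δ.V2) :
    Δ.m s(x, y) = 2 := by
  by_contra hm
  exact hx (Δ.f_eq_two x y h hm).1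

/-- The homomorphism from a Dyer group determined by the images of the generators. The braid
relation is only asked for in the form `(φ x φ y) ^ m = 1` for generators of order `2`. -/
def lift {G : Type*} [Group G] (φ : V → G) (h1 : ∀ x, φ x ^ Δ.ord x = 1)
    (h2 : ∀ x y, Δ.graph.Adj x y → Δ.m s(x, y) = 2 → φ x * φ y = φ y * φ x)
    (h3 : ∀ x y, Δ.graph.Adj x y → x ∈ Δ.V2 → y ∈ Δ.V2 → 2 < Δ.m s(x, y) →
      (φ x * φ y) ^ Δ.m s(x, y) = 1) : Δ.DyerGroup →* G :=
  PresentedGroup.toGroup (f := φ) (by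
    rintro r (⟨x, -, rfl⟩ | ⟨x, y, hxy, rfl⟩)
    · rw [map_pow, FreeGroup.lift_apply_of]
      exact h1 x
    · rw [map_mul, map_inv, map_altProd, map_altProd, FreeGroup.lift_apply_of,
        FreeGroup.lift_apply_of]
      by_cases hm : Δ.m s(x, y) = 2
      · rw [hm]
        simp [altProd, h2 x y hxy hm]
      · obtain ⟨hx, hy⟩ := Δ.f_eq_two x y hxy hm
        have key : ∀ z ∈ Δ.V2, φ z * φ z = 1 := fun z hz => by
          have := h1 z
          rwa [(Δ.ord_eq_two_iff).2 hz, pow_two] at this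
        rw [altProd_mul_inv_eq_pow (key x hx) (key y hy)]
        exact h3 x y hxy hx hy (lt_of_le_of_ne (Δ.two_le_m x y hxy) (Ne.symm hm)))

@[simp] theorem lift_gen {G : Type*} [Group G] (φ : V → G) (h1) (h2) (h3) (x : V) :
    Δ.lift φ h1 h2 h3 (Δ.gen x) = φ x :=
  PresentedGroup.toGroup.of _

theorem gen_induction {p : Δ.DyerGroup → Prop} (one : p 1) (mul : ∀ x g, p g → p (Δ.gen x * g))
    (inv_mul : ∀ x g, p g → p ((Δ.gen x)⁻¹ * g)) (g : Δ.DyerGroup) : p g := by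
  have hg : g ∈ Subgroup.closure (Set.range (PresentedGroup.of (rels := Δ.relators))) := by
    rw [PresentedGroup.closure_range_of]; trivial
  induction hg using Subgroup.closure_induction_left with
  | one => exact one
  | mul_left x hx y _ hy => obtain ⟨x, rfl⟩ := hx; exact mul x y hy
  | inv_mul_cancel x hx y _ hy => obtain ⟨x, rfl⟩ := hx; exact inv_mul x y hy

open Classical in
/-- The exponent sum modulo `ord x` of a vertex `x ∉ V_2`. It is well defined because braid
relations with `m ≠ 2`, which may be of odd length, involve vertices of `V_2` only. -/
noncomputable def exponent (x : V) (hx : x ∉ Δ.V2) :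
    Δ.DyerGroup →* Multiplicative (ZMod (Δ.ord x)) :=
  Δ.lift (fun y => if y = x then Multiplicative.ofAdd 1 else 1)
    (fun y => by
      by_cases h : y = x
      · subst h
        rw [if_pos rfl, ← ofAdd_nsmul]
        simp
      · simp [h])
    (fun y z _ _ => mul_comm _ _)
    (fun y z _ hy hz _ => by
      have hy' : y ≠ x := fun h => hx (h ▸ hy)
      have hz' : z ≠ x := fun h => hx (h ▸ hz)
      simp [hy', hz'])

theorem exponent_gen_self (x : V) (hx : x ∉ Δ.V2) :
    Δ.exponent x hx (Δ.gen x) = Multiplicative.ofAdd 1 := by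
  simp [exponent]

theorem exponent_gen_of_ne {x y : V} (hx : x ∉ Δ.V2) (h : y ≠ x) :
    Δ.exponent x hx (Δ.gen y) = 1 := by
  simp [exponent, h]

theorem exponent_gen_self_ne_one (x : V) (hx : x ∉ Δ.V2) :
    Δ.exponent x hx (Δ.gen x) ≠ 1 := by
  rw [exponent_gen_self]
  intro h
  have h1 : (1 : ZMod (Δ.ord x)) = 0 := h
  have h2 : ((1 : ℕ) : ZMod (Δ.ord x)) = 0 := by exact_mod_cast h1
  rw [ZMod.natCast_eq_zero_iff] at h2
  exact Δ.ord_ne_one x (Nat.dvd_one.1 h2)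

/-! ### The inversion cocycle -/

/-- The coefficient group of the inversion cocycle, a product of cyclic groups of all orders. A common
group for all vertices makes it unnecessary to compare the orders of conjugate generators. -/
abbrev Coeff : Type := ∀ n : ℕ, ZMod n

/-- The standard element of order `n` in the coefficient group (of infinite order for `n = 0`). -/
def theta (n : ℕ) : Coeff := Pi.single n 1

theorem zsmul_theta (n : ℕ) (k : ℤ) : k • theta n = Pi.single n (k : ZMod n) := by
  rw [theta, ← Pi.single_smul]
  simp

theorem zsmul_theta_eq_zero_iff {n : ℕ} {k : ℤ} : k • theta n = 0 ↔ (n : ℤ) ∣ k := by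
  rw [zsmul_theta, Pi.single_eq_zero_iff, ZMod.intCast_zmod_eq_zero_iff_dvd]

open Classical in
/-- The permutation of `D × Coeff` by which the generator `x` acts: it conjugates the first
component and adds `theta (ord x)` to the second one if the first is `x`. -/
noncomputable def inversionPerm (x : V) : Equiv.Perm (Δ.DyerGroup × Coeff) where
  toFun p := (Δ.gen x * p.1 * (Δ.gen x)⁻¹, p.2 + if p.1 = Δ.gen x then theta (Δ.ord x) else 0)
  invFun p := ((Δ.gen x)⁻¹ * p.1 * Δ.gen x, p.2 - if p.1 = Δ.gen x then theta (Δ.ord x) else 0)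
  left_inv p := by
    have : Δ.gen x * p.1 * (Δ.gen x)⁻¹ = Δ.gen x ↔ p.1 = Δ.gen x := by
      rw [mul_inv_eq_iff_eq_mul, mul_right_inj]
    ext1
    · simp only []; group
    · simp [this]
  right_inv p := by
    have : (Δ.gen x)⁻¹ * p.1 * Δ.gen x = Δ.gen x ↔ p.1 = Δ.gen x := by
      rw [mul_eq_right, inv_mul_eq_one, eq_comm]
    ext1
    · simp only []; group
    · simp [this]

open Classical in
theorem inversionPerm_apply (x : V) (t : Δ.DyerGroup) (r : Coeff) :
    Δ.inversionPerm x (t, r) =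
      (Δ.gen x * t * (Δ.gen x)⁻¹, r + if t = Δ.gen x then theta (Δ.ord x) else 0) := rfl

open Classical in
theorem inversionPerm_pow_apply (x : V) (k : ℕ) (t : Δ.DyerGroup) (r : Coeff) :
    (Δ.inversionPerm x ^ k) (t, r) =
      (Δ.gen x ^ k * t * (Δ.gen x ^ k)⁻¹,
        r + if t = Δ.gen x then (k : ℤ) • theta (Δ.ord x) else 0) := by
  induction k generalizing r with
  | zero => simp
  | succ k ih =>
    have : Δ.gen x ^ k * t * (Δ.gen x ^ k)⁻¹ = Δ.gen x ↔ t = Δ.gen x := by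
      rw [mul_inv_eq_iff_eq_mul, ← pow_succ', pow_succ, mul_right_inj]
    rw [pow_succ', Equiv.Perm.mul_apply, ih, inversionPerm_apply]
    ext1
    · simp only [pow_succ', mul_inv_rev]; group
    · simp only [this]
      split_ifs
      · push_cast; rw [add_smul, one_smul, add_assoc]
      · simp

/-- The action of the Dyer group on `D × Coeff` that encodes the inversion cocycle. In the braid
relation the elements `(y x) ^ i y` with `i < 2 m` are passed, each of them twice. -/
noncomputable def inversionHom : Δ.DyerGroup →* Equiv.Perm (Δ.DyerGroup × Coeff) := by
  classical
  refine Δ.lift Δ.inversionPerm ?_ ?_ ?_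
  · intro x
    ext1 ⟨t, r⟩
    rw [inversionPerm_pow_apply, Δ.gen_pow_ord, (zsmul_theta_eq_zero_iff).2 (dvd_refl _)]
    simp
  · intro x y hxy hm
    have hc : Δ.gen x * Δ.gen y = Δ.gen y * Δ.gen x := Δ.commute_gen hxy hm
    ext1 ⟨t, r⟩
    have h1 : Δ.gen y * t * (Δ.gen y)⁻¹ = Δ.gen x ↔ t = Δ.gen x := by
      rw [mul_inv_eq_iff_eq_mul, hc, mul_right_inj]
    have h2 : Δ.gen x * t * (Δ.gen x)⁻¹ = Δ.gen y ↔ t = Δ.gen y := by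
      rw [mul_inv_eq_iff_eq_mul, ← hc, mul_right_inj]
    simp only [Equiv.Perm.mul_apply, inversionPerm_apply, h1, h2]
    ext1
    · calc _ = (Δ.gen x * Δ.gen y) * t * (Δ.gen x * Δ.gen y)⁻¹ := by group
        _ = _ := by rw [hc]; group
    · exact add_right_comm _ _ _
  · intro x y hxy hx hy _
    set a := Δ.gen x
    set b := Δ.gen y
    have ha : a⁻¹ = a := Δ.gen_inv hx
    have hb : b⁻¹ = b := Δ.gen_inv hy
    have hab : (b * a)⁻¹ = a * b := by rw [mul_inv_rev, ha, hb]
    -- The two letters of the `k`-th factor `x y` pass `(y x) ^ (2 k) y` and `(y x) ^ (2 k + 1) y`.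
    have hpow : ∀ k : ℕ, ∀ t r, ((Δ.inversionPerm x * Δ.inversionPerm y) ^ k) (t, r) =
        ((a * b) ^ k * t * ((a * b) ^ k)⁻¹, r + ∑ i ∈ Finset.range (2 * k),
          if t = (b * a) ^ i * b then theta 2 else 0) := by
      intro k
      induction k with
      | zero => intro t r; simp
      | succ k ih =>
        intro t r
        have e1 : (a * b) ^ k * t * ((a * b) ^ k)⁻¹ = b ↔ t = (b * a) ^ (2 * k) * b := by
          rw [mul_inv_eq_iff_eq_mul, ← hab, inv_pow, inv_mul_eq_iff_eq_mul, two_mul, pow_add,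
            mul_assoc, ← inv_pow, hab, ← mul_pow_mul]
        have e2 : b * ((a * b) ^ k * t * ((a * b) ^ k)⁻¹) * b⁻¹ = a ↔
            t = (b * a) ^ (2 * k + 1) * b := by
          rw [mul_inv_eq_iff_eq_mul, ← hb, inv_mul_eq_iff_eq_mul, hb, mul_inv_eq_iff_eq_mul,
            ← hab, inv_pow, inv_mul_eq_iff_eq_mul, ← inv_pow, hab]
          have : (b * a) ^ k * (b * (a * b) * (a * b) ^ k) = (b * a) ^ (2 * k + 1) * b := by
            rw [mul_assoc, ← pow_succ', ← mul_pow_mul, ← mul_assoc, ← pow_add]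
            congr 2; ring
          rw [this]
        rw [pow_succ', Equiv.Perm.mul_apply, ih, Equiv.Perm.mul_apply, inversionPerm_apply,
          inversionPerm_apply]
        ext1
        · change a * (b * _ * b⁻¹) * a⁻¹ = _
          rw [pow_succ', mul_inv_rev, mul_inv_rev]; simp only [mul_assoc]
        · change _ + _ + _ = _
          rw [if_congr e1 rfl rfl, if_congr e2 rfl rfl, (Δ.ord_eq_two_iff).2 hx,
            (Δ.ord_eq_two_iff).2 hy, show 2 * (k + 1) = 2 * k + 1 + 1 by ring,
            Finset.sum_range_succ, Finset.sum_range_succ, ← add_assoc, ← add_assoc]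
    have hm := Δ.mul_gen_pow_m hxy hx hy
    have hm' : (b * a) ^ Δ.m s(x, y) = 1 := by
      rw [← inv_inj, ← inv_pow, hab, inv_one]; exact hm
    ext1 ⟨t, r⟩
    rw [hpow, hm, two_mul, Finset.sum_range_add]
    simp only [pow_add, hm', one_mul, inv_one, mul_one, Equiv.Perm.coe_one, id]
    -- As `(y x) ^ m = 1`, both halves of the sum agree, and `theta 2` has order `2`.
    rw [← two_nsmul, Finset.smul_sum, Finset.sum_eq_zero, add_zero]
    intro i _
    split_ifs
    · rw [← natCast_zsmul]; exact zsmul_theta_eq_zero_iff.2 (dvd_refl _)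
    · exact nsmul_zero _

/-- The inversion cocycle: `inversion g t` counts, in `Coeff`, how often the conjugate `t` of a
generator occurs among the right inversions of `g`. -/
noncomputable def inversion (g t : Δ.DyerGroup) : Coeff := (Δ.inversionHom g (t, 0)).2

theorem inversionHom_gen (x : V) : Δ.inversionHom (Δ.gen x) = Δ.inversionPerm x := by
  simp [inversionHom]

theorem inversionHom_apply (g t : Δ.DyerGroup) (r : Coeff) :
    Δ.inversionHom g (t, r) = (g * t * g⁻¹, r + Δ.inversion g t) := by
  classical
  have key : ∃ e : Δ.DyerGroup → Coeff, ∀ t r,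
      Δ.inversionHom g (t, r) = (g * t * g⁻¹, r + e t) := by
    induction g using Δ.gen_induction with
    | one => exact ⟨0, fun t r => by simp⟩
    | mul x g ih =>
      obtain ⟨e, he⟩ := ih
      refine ⟨fun t => e t + if g * t * g⁻¹ = Δ.gen x then theta (Δ.ord x) else 0,
        fun t r => ?_⟩
      rw [map_mul, Equiv.Perm.mul_apply, he, inversionHom_gen, inversionPerm_apply, add_assoc,
        mul_inv_rev]
      simp only [mul_assoc]
    | inv_mul x g ih =>
      obtain ⟨e, he⟩ := ih
      refine ⟨fun t => e t - if g * t * g⁻¹ = Δ.gen x then theta (Δ.ord x) else 0,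
        fun t r => ?_⟩
      rw [map_mul, Equiv.Perm.mul_apply, he, map_inv, inversionHom_gen]
      change ((Δ.gen x)⁻¹ * (g * t * g⁻¹) * Δ.gen x, r + e t - _) = _
      rw [add_sub_assoc, mul_inv_rev]
      simp only [mul_assoc, inv_inv]
  obtain ⟨e, he⟩ := key
  rw [inversion, he, he, zero_add]

theorem inversion_mul (g h t : Δ.DyerGroup) :
    Δ.inversion (g * h) t = Δ.inversion h t + Δ.inversion g (h * t * h⁻¹) := by
  rw [inversion, map_mul, Equiv.Perm.mul_apply, inversionHom_apply, inversionHom_apply, zero_add]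

@[simp] theorem inversion_one (t : Δ.DyerGroup) : Δ.inversion 1 t = 0 := by simp [inversion]

theorem inversion_inv (g t : Δ.DyerGroup) : Δ.inversion g⁻¹ t = -Δ.inversion g (g⁻¹ * t * g) := by
  have := Δ.inversion_mul g g⁻¹ t
  rw [mul_inv_cancel, inversion_one, inv_inv] at this
  exact eq_neg_of_add_eq_zero_left this.symm

open Classical in
theorem inversion_gen (x : V) (t : Δ.DyerGroup) :
    Δ.inversion (Δ.gen x) t = if t = Δ.gen x then theta (Δ.ord x) else 0 := by
  simp [inversion, inversionHom_gen, inversionPerm_apply]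

open Classical in
theorem inversion_gen_zpow (x : V) (k : ℤ) (t : Δ.DyerGroup) :
    Δ.inversion (Δ.gen x ^ k) t = if t = Δ.gen x then k • theta (Δ.ord x) else 0 := by
  have hpow : ∀ (k : ℕ) (t : Δ.DyerGroup), Δ.inversion (Δ.gen x ^ k) t =
      if t = Δ.gen x then (k : ℤ) • theta (Δ.ord x) else 0 := by
    intro k t
    simp [inversion, inversionHom_gen, inversionPerm_pow_apply]
  obtain ⟨k, rfl | rfl⟩ := k.eq_nat_or_neg
  · rw [zpow_natCast, hpow]
  · have h1 : (Δ.gen x ^ k)⁻¹ * t * Δ.gen x ^ k = Δ.gen x ↔ t = Δ.gen x := by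
      rw [mul_assoc, inv_mul_eq_iff_eq_mul, ← pow_succ, pow_succ', mul_left_inj]
    rw [zpow_neg, zpow_natCast, inversion_inv, hpow, if_congr h1 rfl rfl]
    split_ifs
    · rw [neg_smul]
    · exact neg_zero

/-! ### Syllabic words and the exchange property -/

/-- The element `s₁ ^ a₁ * ⋯ * sₙ ^ aₙ` represented by a syllabic word. -/
def eval (w : List (V × ℤ)) : Δ.DyerGroup := (w.map fun p => Δ.gen p.1 ^ p.2).prod

/-- The weight `|a₁| + ⋯ + |aₙ|` of a syllabic word. -/
def weight (w : List (V × ℤ)) : ℕ := (w.map fun p => p.2.natAbs).sum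

@[simp] theorem eval_nil : Δ.eval [] = 1 := rfl

@[simp] theorem eval_cons (p : V × ℤ) (w : List (V × ℤ)) :
    Δ.eval (p :: w) = Δ.gen p.1 ^ p.2 * Δ.eval w := by simp [eval]

@[simp] theorem eval_append (u v : List (V × ℤ)) : Δ.eval (u ++ v) = Δ.eval u * Δ.eval v := by
  simp [eval]

@[simp] theorem weight_nil : weight ([] : List (V × ℤ)) = 0 := rfl

@[simp] theorem weight_cons (p : V × ℤ) (w : List (V × ℤ)) :
    weight (p :: w) = p.2.natAbs + weight w := by simp [weight]

@[simp] theorem weight_append (u v : List (V × ℤ)) : weight (u ++ v) = weight u + weight v := by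
  simp [weight]

theorem gen_mem_parabolic {X : Set V} {x : V} (hx : x ∈ X) : Δ.gen x ∈ Δ.parabolic X :=
  Subgroup.subset_closure (Set.mem_image_of_mem _ hx)

theorem eval_mem_parabolic {X : Set V} {w : List (V × ℤ)} (hw : ∀ p ∈ w, p.1 ∈ X) :
    Δ.eval w ∈ Δ.parabolic X := by
  refine Subgroup.list_prod_mem _ ?_
  simp only [List.mem_map]
  rintro _ ⟨p, hp, rfl⟩
  exact Subgroup.zpow_mem _ (Δ.gen_mem_parabolic (hw p hp)) _

theorem exists_eval_of_mem_parabolic {X : Set V} {g : Δ.DyerGroup} (hg : g ∈ Δ.parabolic X) :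
    ∃ w : List (V × ℤ), (∀ p ∈ w, p.1 ∈ X) ∧ Δ.eval w = g := by
  induction hg using Subgroup.closure_induction_left with
  | one => exact ⟨[], by simp, rfl⟩
  | mul_left x hx y _ hy =>
    obtain ⟨x, hxX, rfl⟩ := hx
    obtain ⟨w, hw, rfl⟩ := hy
    exact ⟨(x, 1) :: w, by simpa using ⟨hxX, fun a b h => hw (a, b) h⟩, by simp⟩
  | inv_mul_cancel x hx y _ hy =>
    obtain ⟨x, hxX, rfl⟩ := hx
    obtain ⟨w, hw, rfl⟩ := hy
    exact ⟨(x, -1) :: w, by simpa using ⟨hxX, fun a b h => hw (a, b) h⟩, by simp⟩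

theorem parabolic_univ : Δ.parabolic Set.univ = ⊤ := by
  rw [parabolic, Set.image_univ]
  exact PresentedGroup.closure_range_of _

/-- Every inversion of the element represented by a word comes from one of its syllables. -/
theorem exists_split {w : List (V × ℤ)} {t : Δ.DyerGroup} (h : Δ.inversion (Δ.eval w) t ≠ 0) :
    ∃ u s k v, w = u ++ (s, k) :: v ∧ Δ.eval v * t * (Δ.eval v)⁻¹ = Δ.gen s := by
  induction w with
  | nil => simp at h
  | cons p w ih =>
    by_cases hp : Δ.eval w * t * (Δ.eval w)⁻¹ = Δ.gen p.1
    · exact ⟨[], p.1, p.2, w, rfl, hp⟩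
    · rw [eval_cons, inversion_mul, inversion_gen_zpow, if_neg hp, add_zero] at h
      obtain ⟨u, s, k, v, rfl, hv⟩ := ih h
      exact ⟨p :: u, s, k, v, rfl, hv⟩

/-- Multiplying by a power of an inversion changes the exponent of the syllable it comes from. -/
theorem eval_mul_zpow {u v : List (V × ℤ)} {s : V} {t : Δ.DyerGroup}
    (h : Δ.eval v * t * (Δ.eval v)⁻¹ = Δ.gen s) (k j : ℤ) :
    Δ.eval (u ++ (s, k) :: v) * t ^ j = Δ.eval (u ++ (s, k + j) :: v) := by
  have : Δ.gen s ^ j = Δ.eval v * t ^ j * (Δ.eval v)⁻¹ := by rw [← h, conj_zpow]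
  simp only [eval_append, eval_cons, zpow_add, this]
  group

theorem gen_zpow_of_dvd {x : V} {k : ℤ} (h : (Δ.ord x : ℤ) ∣ k) : Δ.gen x ^ k = 1 := by
  obtain ⟨c, rfl⟩ := h
  rw [zpow_mul, zpow_natCast, Δ.gen_pow_ord, one_zpow]

theorem gen_zpow_congr {x : V} {k l : ℤ} (h : (k : ZMod (Δ.ord x)) = l) :
    Δ.gen x ^ k = Δ.gen x ^ l := by
  rw [ZMod.intCast_eq_intCast_iff_dvd_sub] at h
  have := Δ.gen_zpow_of_dvd h
  rw [zpow_sub, mul_inv_eq_one] at this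
  exact this.symm

/-- A word is good if its syllables are nontrivial and no two of its syllables give the same
inversion. These are the words of least syllable length. -/
def Good : List (V × ℤ) → Prop
  | [] => True
  | p :: w => ¬ (Δ.ord p.1 : ℤ) ∣ p.2 ∧
      Δ.inversion (Δ.eval w) ((Δ.eval w)⁻¹ * Δ.gen p.1 * Δ.eval w) = 0 ∧ Good w

theorem Good.not_dvd {w : List (V × ℤ)} (h : Δ.Good w) : ∀ p ∈ w, ¬ (Δ.ord p.1 : ℤ) ∣ p.2 := by
  induction w with
  | nil => simp
  | cons q w ih =>
    intro p hp
    rcases List.mem_cons.1 hp with rfl | hp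
    · exact h.1
    · exact ih h.2.2 p hp

/-- Merging syllables with equal inversions turns a word into a good one. -/
theorem exists_good (X : Set V) (n : ℕ) (w : List (V × ℤ)) (hn : w.length ≤ n)
    (hX : ∀ p ∈ w, p.1 ∈ X) :
    ∃ w', Δ.Good w' ∧ Δ.eval w' = Δ.eval w ∧ w'.length ≤ w.length ∧ weight w' ≤ weight w ∧
      ∀ p ∈ w', p.1 ∈ X := by
  induction n generalizing w with
  | zero =>
    obtain rfl := List.length_eq_zero_iff.1 (Nat.le_zero.1 hn)
    exact ⟨[], trivial, rfl, le_rfl, le_rfl, hX⟩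
  | succ n ih =>
    match w with
    | [] => exact ⟨[], trivial, rfl, le_rfl, le_rfl, hX⟩
    | (x, k) :: w =>
      have hn' : w.length ≤ n := by simpa using hn
      obtain ⟨w', hg, he, hl, hw, hX'⟩ := ih w hn' fun p hp => hX p (List.mem_cons_of_mem _ hp)
      have hxX : x ∈ X := hX (x, k) (List.mem_cons_self ..)
      by_cases hd : (Δ.ord x : ℤ) ∣ k
      · refine ⟨w', hg, ?_, ?_, ?_, hX'⟩
        · simp [he, Δ.gen_zpow_of_dvd hd]
        · simp only [List.length_cons]; omega
        · simp only [weight_cons]; omega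
      set t := (Δ.eval w')⁻¹ * Δ.gen x * Δ.eval w' with ht
      by_cases hi : Δ.inversion (Δ.eval w') t = 0
      · refine ⟨(x, k) :: w', ⟨hd, hi, hg⟩, by simp [he], by simpa using hl, by simpa using hw, ?_⟩
        intro p hp
        rcases List.mem_cons.1 hp with rfl | hp
        · exact hxX
        · exact hX' p hp
      · -- `x ^ k * eval w' = eval w' * t ^ k`, and `t ^ k` is absorbed by a syllable of `w'`.
        obtain ⟨u, s, j, v, huv, hv⟩ := Δ.exists_split hi
        have hX'' : ∀ p ∈ u ++ (s, j + k) :: v, p.1 ∈ X := by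
          intro p hp
          rw [huv] at hX'
          simp only [List.mem_append, List.mem_cons] at hp hX'
          rcases hp with hp | rfl | hp
          · exact hX' p (Or.inl hp)
          · exact hX' (s, j) (Or.inr (Or.inl rfl))
          · exact hX' p (Or.inr (Or.inr hp))
        have hlen : (u ++ (s, j + k) :: v).length = w'.length := by simp [huv]
        obtain ⟨w'', hg'', he'', hl'', hw'', hXX⟩ := ih _ (by omega) hX''
        refine ⟨w'', hg'', ?_, ?_, ?_, hXX⟩
        · rw [he'', ← Δ.eval_mul_zpow hv, ← huv, eval_cons, ← he]
          have : t ^ k = (Δ.eval w')⁻¹ * Δ.gen x ^ k * Δ.eval w' := by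
            have := conj_zpow (i := k) (a := (Δ.eval w')⁻¹) (b := Δ.gen x)
            rwa [inv_inv] at this
          rw [this]; group
        · simp only [List.length_cons]; omega
        · refine hw''.trans ?_
          rw [huv] at hw
          simp only [weight_append, weight_cons] at hw ⊢
          have := Int.natAbs_add_le j k
          omega

/-! ### Norms computed from the inversion cocycle -/

theorem finite_support_inversion (g : Δ.DyerGroup) :
    (Function.support (Δ.inversion g)).Finite := by
  obtain ⟨w, -, rfl⟩ := Δ.exists_eval_of_mem_parabolic (X := Set.univ) (g := g)
    (by rw [parabolic_univ]; trivial)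
  induction w with
  | nil =>
    convert Set.finite_empty
    ext t; simp
  | cons p w ih =>
    refine (ih.union (Set.finite_singleton ((Δ.eval w)⁻¹ * Δ.gen p.1 * Δ.eval w))).subset ?_
    intro t ht
    by_contra hn
    simp only [Set.mem_union, Set.mem_singleton_iff, not_or, Function.mem_support, not_not] at hn
    refine ht ?_
    rw [eval_cons, inversion_mul, hn.1, inversion_gen_zpow, if_neg, add_zero]
    intro h
    apply hn.2
    rw [← h]; group

/-- The sum of the values of `ν` over all inversions of `g`. It is only used with `ν 0 = 0`, where
the sum has finite support. -/
noncomputable def norm (ν : Coeff → ℕ) (g : Δ.DyerGroup) : ℕ := ∑ᶠ t, ν (Δ.inversion g t)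

variable {ν : Coeff → ℕ}

theorem finite_support_comp_inversion (hν : ν 0 = 0) (g : Δ.DyerGroup) :
    (Function.support fun t => ν (Δ.inversion g t)).Finite :=
  (Δ.finite_support_inversion g).subset fun t ht h => ht (by simp only [h, hν])

theorem norm_one (hν : ν 0 = 0) : Δ.norm ν 1 = 0 := by simp [norm, hν]

theorem norm_gen_zpow (hν : ν 0 = 0) (x : V) (k : ℤ) :
    Δ.norm ν (Δ.gen x ^ k) = ν (k • theta (Δ.ord x)) := by
  rw [norm, finsum_eq_single _ (Δ.gen x)]
  · rw [inversion_gen_zpow, if_pos rfl]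
  · intro t ht
    rw [inversion_gen_zpow, if_neg ht, hν]

/-- Norms are additive on products in which no inversion of the first factor is cancelled. -/
theorem norm_mul (hν : ν 0 = 0) {a h : Δ.DyerGroup}
    (hd : ∀ t, Δ.inversion h t ≠ 0 → Δ.inversion a (h * t * h⁻¹) = 0) :
    Δ.norm ν (a * h) = Δ.norm ν a + Δ.norm ν h := by
  have h1 : ∀ t, ν (Δ.inversion (a * h) t) =
      ν (Δ.inversion a (h * t * h⁻¹)) + ν (Δ.inversion h t) := by
    intro t
    rw [inversion_mul]
    by_cases ht : Δ.inversion h t = 0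
    · rw [ht, hν, zero_add, add_zero]
    · rw [hd t ht, hν, zero_add, add_zero]
  have h2 : ∑ᶠ t, ν (Δ.inversion a (h * t * h⁻¹)) = ∑ᶠ t, ν (Δ.inversion a t) :=
    finsum_comp_equiv (MulAut.conj h).toEquiv (f := fun t => ν (Δ.inversion a t))
  have h3 : (Function.support fun t => ν (Δ.inversion a (h * t * h⁻¹))).Finite := by
    have := (Δ.finite_support_comp_inversion hν a).preimage
      (f := fun t => h * t * h⁻¹) (fun x _ y _ hxy => by simpa using hxy)
    exact this
  simp only [norm, h1]
  rw [finsum_add_distrib h3 (Δ.finite_support_comp_inversion hν h), h2]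

theorem Good.norm_eval (hν : ν 0 = 0) {w : List (V × ℤ)} (h : Δ.Good w) :
    Δ.norm ν (Δ.eval w) = (w.map fun p => ν (p.2 • theta (Δ.ord p.1))).sum := by
  induction w with
  | nil => exact Δ.norm_one hν
  | cons p w ih =>
    rw [eval_cons, Δ.norm_mul hν, ih h.2.2, Δ.norm_gen_zpow hν, List.map_cons, List.sum_cons]
    intro t ht
    rw [inversion_gen_zpow, if_neg]
    intro hc
    apply ht
    rw [← h.2.1, ← hc]
    congr 1
    group

open Classical in
/-- The indicator of the nonzero elements of `Coeff`. -/
noncomputable def indicator (r : Coeff) : ℕ := if r = 0 then 0 else 1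

/-- The sum of the absolute values of the least residues of the entries. For a multiple of
`theta n` only the entry at `n` contributes. -/
noncomputable def absSum (r : Coeff) : ℕ := ∑ᶠ n, (r n).valMinAbs.natAbs

@[simp] theorem indicator_zero : indicator 0 = 0 := if_pos rfl

@[simp] theorem absSum_zero : absSum 0 = 0 := by simp [absSum]

theorem absSum_zsmul_theta (n : ℕ) (k : ℤ) :
    absSum (k • theta n) = (k : ZMod n).valMinAbs.natAbs := by
  rw [absSum, zsmul_theta, finsum_eq_single _ n]
  · rw [Pi.single_eq_same]
  · intro m hm
    rw [Pi.single_eq_of_ne hm]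
    simp

theorem natAbs_valMinAbs_intCast_le (n : ℕ) (k : ℤ) :
    (k : ZMod n).valMinAbs.natAbs ≤ k.natAbs := by
  rcases Nat.eq_zero_or_pos n with rfl | hn
  · exact le_rfl
  · have : NeZero n := ⟨hn.ne'⟩
    apply ZMod.natAbs_min_of_le_div_two n
    · simp
    · exact ZMod.natAbs_valMinAbs_le _

/-- The syllable length, as a function on the Dyer group. -/
noncomputable def sylNorm (g : Δ.DyerGroup) : ℕ := Δ.norm indicator g

/-- The word length, as a function on the Dyer group. -/
noncomputable def wordNorm (g : Δ.DyerGroup) : ℕ := Δ.norm absSum g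

theorem Good.sylNorm_eval {w : List (V × ℤ)} (h : Δ.Good w) :
    Δ.sylNorm (Δ.eval w) = w.length := by
  rw [sylNorm, Good.norm_eval Δ indicator_zero h]
  have h1 : w.map (fun p => indicator (p.2 • theta (Δ.ord p.1))) = w.map fun _ => 1 := by
    refine List.map_congr_left fun p hp => ?_
    rw [indicator, if_neg]
    rw [zsmul_theta_eq_zero_iff]
    exact Good.not_dvd Δ h p hp
  rw [h1]; simp

theorem Good.wordNorm_eval {w : List (V × ℤ)} (h : Δ.Good w) :
    Δ.wordNorm (Δ.eval w) =
      (w.map fun p => (p.2 : ZMod (Δ.ord p.1)).valMinAbs.natAbs).sum := by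
  rw [wordNorm, Good.norm_eval Δ absSum_zero h]
  simp only [absSum_zsmul_theta]

theorem sylNorm_eval_le (w : List (V × ℤ)) : Δ.sylNorm (Δ.eval w) ≤ w.length := by
  obtain ⟨w', hg, he, hl, -, -⟩ := Δ.exists_good Set.univ w.length w le_rfl (by simp)
  rw [← he, Good.sylNorm_eval Δ hg]
  exact hl

theorem wordNorm_eval_le (w : List (V × ℤ)) : Δ.wordNorm (Δ.eval w) ≤ weight w := by
  obtain ⟨w', hg, he, -, hw, -⟩ := Δ.exists_good Set.univ w.length w le_rfl (by simp)
  rw [← he, Good.wordNorm_eval Δ hg]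
  refine le_trans ?_ hw
  exact List.sum_le_sum fun p _ => natAbs_valMinAbs_intCast_le _ _

/-- The elements of `D_X` have words in `X` that are simultaneously of least syllable length and
of least weight. -/
theorem exists_word {X : Set V} {g : Δ.DyerGroup} (hg : g ∈ Δ.parabolic X) :
    ∃ w : List (V × ℤ), (∀ p ∈ w, p.1 ∈ X) ∧ Δ.Good w ∧ Δ.eval w = g ∧
      w.length = Δ.sylNorm g ∧ weight w = Δ.wordNorm g := by
  obtain ⟨w, hX, rfl⟩ := Δ.exists_eval_of_mem_parabolic hg
  obtain ⟨w, hw, he, -, -, hX⟩ := Δ.exists_good X w.length w le_rfl hX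
  rw [← he]
  -- Replacing the exponents by their least residues minimizes the weight.
  let r : V × ℤ → V × ℤ := fun p => (p.1, (p.2 : ZMod (Δ.ord p.1)).valMinAbs)
  have hr : ∀ w : List (V × ℤ), Δ.eval (w.map r) = Δ.eval w := by
    intro w
    induction w with
    | nil => rfl
    | cons p w ih =>
      rw [List.map_cons, eval_cons, eval_cons, ih]
      congr 1
      exact Δ.gen_zpow_congr (by simp [r])
  have hg : ∀ w : List (V × ℤ), Δ.Good w → Δ.Good (w.map r) := by
    intro w
    induction w with
    | nil => exact id
    | cons p w ih =>
      rintro ⟨h1, h2, h3⟩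
      refine ⟨?_, ?_, ih h3⟩
      · rw [← ZMod.intCast_zmod_eq_zero_iff_dvd] at h1 ⊢
        simpa [r] using h1
      · rw [hr]; exact h2
  refine ⟨w.map r, ?_, hg w hw, hr w, ?_, ?_⟩
  · intro p hp
    obtain ⟨q, hq, rfl⟩ := List.mem_map.1 hp
    exact hX q hq
  · rw [List.length_map, Good.sylNorm_eval Δ hw]
  · rw [Good.wordNorm_eval Δ hw, weight, List.map_map]
    rfl

theorem exists_word' (g : Δ.DyerGroup) :
    ∃ w : List (V × ℤ), Δ.Good w ∧ Δ.eval w = g ∧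
      w.length = Δ.sylNorm g ∧ weight w = Δ.wordNorm g := by
  obtain ⟨w, -, h⟩ := Δ.exists_word (X := Set.univ) (g := g) (by rw [parabolic_univ]; trivial)
  exact ⟨w, h⟩

theorem eq_one_of_sylNorm_eq_zero {g : Δ.DyerGroup} (h : Δ.sylNorm g = 0) : g = 1 := by
  obtain ⟨w, -, rfl, hl, -⟩ := Δ.exists_word' g
  rw [h] at hl
  rw [List.length_eq_zero_iff.1 hl]; rfl

/-- Exchange: an inversion `t` of `g` can be removed by multiplying with a power of `t`. -/
theorem exists_zpow_lt {g t : Δ.DyerGroup} (h : Δ.inversion g t ≠ 0) :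
    ∃ j : ℤ, Δ.sylNorm (g * t ^ j) < Δ.sylNorm g ∧ Δ.wordNorm (g * t ^ j) < Δ.wordNorm g := by
  obtain ⟨w, hg, rfl, hl, hw⟩ := Δ.exists_word' g
  obtain ⟨u, s, k, v, rfl, hv⟩ := Δ.exists_split h
  have hk : k ≠ 0 := by
    rintro rfl
    exact Good.not_dvd Δ hg (s, 0) (by simp) (dvd_zero _)
  have he : Δ.eval (u ++ (s, k) :: v) * t ^ (-k) = Δ.eval (u ++ v) := by
    rw [Δ.eval_mul_zpow hv]; simp
  refine ⟨-k, ?_, ?_⟩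
  · rw [he, ← hl]
    refine (Δ.sylNorm_eval_le _).trans_lt ?_
    simp
  · rw [he, ← hw]
    refine (Δ.wordNorm_eval_le _).trans_lt ?_
    simp only [weight_append, weight_cons]
    have := Int.natAbs_pos.2 hk
    omega

theorem exists_conj_of_inversion_ne_zero {X : Set V} {h t : Δ.DyerGroup}
    (hh : h ∈ Δ.parabolic X) (ht : Δ.inversion h t ≠ 0) :
    ∃ x ∈ X, ∃ v ∈ Δ.parabolic X, t = v⁻¹ * Δ.gen x * v := by
  obtain ⟨w, hX, rfl⟩ := Δ.exists_eval_of_mem_parabolic hh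
  obtain ⟨u, s, k, v, rfl, hv⟩ := Δ.exists_split ht
  refine ⟨s, hX (s, k) (by simp), Δ.eval v, Δ.eval_mem_parabolic fun p hp => hX p ?_, ?_⟩
  · simp [hp]
  · rw [← hv]; group

/-! ### The lengths of the statement -/

theorem syllableLength_eq (g : Δ.DyerGroup) : syllableLength Δ.gens g = Δ.sylNorm g := by
  have key : ∀ w : List (Δ.DyerGroup × ℤ), (∀ p ∈ w, p.1 ∈ Δ.gens) →
      Δ.sylNorm (w.map fun p => p.1 ^ p.2).prod ≤ w.length := by
    intro w hw
    have : ∃ w' : List (V × ℤ), w'.length = w.length ∧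
        Δ.eval w' = (w.map fun p => p.1 ^ p.2).prod := by
      induction w with
      | nil => exact ⟨[], rfl, rfl⟩
      | cons p w ih =>
        obtain ⟨w', hl, he⟩ := ih fun p hp => hw p (List.mem_cons_of_mem _ hp)
        obtain ⟨x, hx⟩ := hw p (List.mem_cons_self ..)
        exact ⟨(x, p.2) :: w', by simp [hl], by simp [he, hx]⟩
    obtain ⟨w', hl, he⟩ := this
    rw [← he, ← hl]
    exact Δ.sylNorm_eval_le w'
  apply le_antisymm
  · obtain ⟨w, -, rfl, hl, -⟩ := Δ.exists_word' g
    apply Nat.sInf_le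
    refine ⟨w.map fun p => (Δ.gen p.1, p.2), by simpa using hl, ?_, ?_⟩
    · intro p hp
      obtain ⟨q, -, rfl⟩ := List.mem_map.1 hp
      exact ⟨q.1, rfl⟩
    · rw [List.map_map]; rfl
  · obtain ⟨w, -, rfl, hl, -⟩ := Δ.exists_word' g
    refine le_csInf ⟨w.length, w.map fun p => (Δ.gen p.1, p.2), by simp, ?_, ?_⟩ ?_
    · intro p hp
      obtain ⟨q, -, rfl⟩ := List.mem_map.1 hp
      exact ⟨q.1, rfl⟩
    · rw [List.map_map]; rfl
    · rintro n ⟨w', rfl, hS, he⟩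
      rw [← he]
      exact key w' hS

/-- Word length may be computed along an injective homomorphism that maps the generators onto the
vertices in `X`. -/
theorem wordLength_eq_of_injective {H : Type*} [Group H] (φ : H →* Δ.DyerGroup)
    (hφ : Function.Injective φ) (X : Set V) (S : Set H) (hS : φ '' S = Δ.gen '' X) (g : H)
    (hg : φ g ∈ Δ.parabolic X) : wordLength S g = Δ.wordNorm (φ g) := by
  have upper : ∀ w : List (V × ℤ), (∀ p ∈ w, p.1 ∈ X) → ∃ l : List H, l.length = weight w ∧
      (∀ s ∈ l, s ∈ S ∨ s⁻¹ ∈ S) ∧ φ l.prod = Δ.eval w := by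
    intro w hw
    induction w with
    | nil => exact ⟨[], rfl, by simp, by simp⟩
    | cons p w ih =>
      obtain ⟨l, hl, hlS, he⟩ := ih fun p hp => hw p (List.mem_cons_of_mem _ hp)
      obtain ⟨s, hs, hsp⟩ : Δ.gen p.1 ∈ φ '' S := by
        rw [hS]; exact ⟨_, hw p (List.mem_cons_self ..), rfl⟩
      obtain ⟨n, hn⟩ := p.2.eq_nat_or_neg
      rcases hn with hn | hn
      · refine ⟨List.replicate n s ++ l, by simp [hn, hl], ?_, by simp [he, hsp, hn]⟩
        intro r hr
        rcases List.mem_append.1 hr with hr | hr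
        · rw [List.eq_of_mem_replicate hr]; exact Or.inl hs
        · exact hlS r hr
      · refine ⟨List.replicate n s⁻¹ ++ l, by simp [hn, hl], ?_, by simp [he, hsp, hn]⟩
        intro r hr
        rcases List.mem_append.1 hr with hr | hr
        · rw [List.eq_of_mem_replicate hr, inv_inv]; exact Or.inr hs
        · exact hlS r hr
  obtain ⟨w, hX, -, he, -, hw⟩ := Δ.exists_word hg
  obtain ⟨l, hl, hlS, hle⟩ := upper w hX
  have hlg : l.prod = g := hφ (hle.trans he)
  apply le_antisymm
  · exact Nat.sInf_le ⟨l, hl.trans hw, hlS, hlg⟩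
  · refine le_csInf ⟨_, l, rfl, hlS, hlg⟩ ?_
    rintro n ⟨l', rfl, hS', rfl⟩
    have : ∃ w : List (V × ℤ), weight w = l'.length ∧ Δ.eval w = φ l'.prod := by
      clear hg he hlg hl hle hw
      induction l' with
      | nil => exact ⟨[], rfl, by simp⟩
      | cons s l' ih =>
        obtain ⟨w, hw, he⟩ := ih fun s hs => hS' s (List.mem_cons_of_mem _ hs)
        rcases hS' s (List.mem_cons_self ..) with h | h
        · obtain ⟨x, -, hx⟩ : φ s ∈ Δ.gen '' X := by rw [← hS]; exact ⟨s, h, rfl⟩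
          exact ⟨(x, 1) :: w, by simp [hw, add_comm], by simp [he, hx]⟩
        · obtain ⟨x, -, hx⟩ : φ s⁻¹ ∈ Δ.gen '' X := by rw [← hS]; exact ⟨_, h, rfl⟩
          exact ⟨(x, -1) :: w, by simp [hw, add_comm], by simp [he, hx]⟩
    obtain ⟨w, hw, he⟩ := this
    rw [← he, ← hw]
    exact Δ.wordNorm_eval_le w

theorem wordLength_gens (g : Δ.DyerGroup) : wordLength Δ.gens g = Δ.wordNorm g :=
  Δ.wordLength_eq_of_injective (MonoidHom.id _) Function.injective_id Set.univ _
    (by simp [gens]) g (by rw [parabolic_univ]; trivial)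

theorem wordLength_parabolicGens (X : Set V) (g : Δ.parabolic X) :
    wordLength (Δ.parabolicGens X) g = Δ.wordNorm g := by
  refine Δ.wordLength_eq_of_injective (Δ.parabolic X).subtype Subtype.val_injective X _ ?_ g g.2
  ext h
  constructor
  · rintro ⟨g, hg, rfl⟩; exact hg
  · intro hh
    refine ⟨⟨h, ?_⟩, hh, rfl⟩
    exact Subgroup.subset_closure hh

/-! ### Minimal coset representatives -/

theorem isMinimal_iff {X : Set V} {g : Δ.DyerGroup} :
    Δ.IsMinimal X g ↔ ∀ h ∈ Δ.parabolic X, Δ.sylNorm g ≤ Δ.sylNorm (g * h) := by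
  simp only [IsMinimal, syllableLength_eq]

/-- Norms are additive on `A_X · D_X`: an inversion in `D_X` of the first factor would lead to a
shorter element of its coset. -/
theorem norm_mul_of_isMinimal (hν : ν 0 = 0) {X : Set V} {a h : Δ.DyerGroup}
    (ha : Δ.IsMinimal X a) (hh : h ∈ Δ.parabolic X) :
    Δ.norm ν (a * h) = Δ.norm ν a + Δ.norm ν h := by
  refine Δ.norm_mul hν fun t ht => ?_
  by_contra hc
  obtain ⟨x, hx, v, hv, rfl⟩ := Δ.exists_conj_of_inversion_ne_zero hh ht
  obtain ⟨j, hj, -⟩ := Δ.exists_zpow_lt hc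
  refine absurd ((Δ.isMinimal_iff).1 ha _ (Subgroup.zpow_mem _ ?_ j)) (not_le.2 hj)
  have hx := Δ.gen_mem_parabolic hx
  exact mul_mem (mul_mem hh (mul_mem (mul_mem (inv_mem hv) hx) hv)) (inv_mem hh)

theorem exists_isMinimal_mul (X : Set V) (g : Δ.DyerGroup) :
    ∃ a h, Δ.IsMinimal X a ∧ h ∈ Δ.parabolic X ∧ a * h = g := by
  obtain ⟨h, hh⟩ : ∃ h : Δ.parabolic X, ∀ h' : Δ.parabolic X,
      Δ.sylNorm (g * h) ≤ Δ.sylNorm (g * h') :=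
    ⟨_, fun h' => Function.argmin_le (fun h : Δ.parabolic X => Δ.sylNorm (g * h)) h'⟩
  refine ⟨g * h, (h : Δ.DyerGroup)⁻¹, ?_, inv_mem h.2, by simp⟩
  rw [isMinimal_iff]
  intro h' hh'
  have := hh (h * ⟨h', hh'⟩)
  simpa [mul_assoc] using this

theorem eq_of_isMinimal_mul_eq {X : Set V} {a a' h h' : Δ.DyerGroup} (ha : Δ.IsMinimal X a)
    (ha' : Δ.IsMinimal X a') (hh : h ∈ Δ.parabolic X) (hh' : h' ∈ Δ.parabolic X)
    (he : a * h = a' * h') : a = a' ∧ h = h' := by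
  have h1 : a' = a * (h * h'⁻¹) := by rw [← mul_assoc, he]; simp
  have h2 : a = a' * (h' * h⁻¹) := by rw [← mul_assoc, ← he]; simp
  have h3 := Δ.norm_mul_of_isMinimal indicator_zero ha (mul_mem hh (inv_mem hh'))
  have h4 := Δ.norm_mul_of_isMinimal indicator_zero ha' (mul_mem hh' (inv_mem hh))
  rw [← h1] at h3
  rw [← h2] at h4
  have h5 : h * h'⁻¹ = 1 := Δ.eq_one_of_sylNorm_eq_zero (by rw [sylNorm]; omega)
  have h6 : h = h' := mul_inv_eq_one.1 h5
  subst h6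
  exact ⟨mul_right_cancel he, rfl⟩

theorem isMinimal_singleton_iff {x : V} {g : Δ.DyerGroup} :
    Δ.IsMinimal {x} g ↔ Δ.inversion g (Δ.gen x) = 0 := by
  constructor
  · intro hg
    by_contra hc
    obtain ⟨j, hj, -⟩ := Δ.exists_zpow_lt hc
    exact absurd ((Δ.isMinimal_iff).1 hg _ (Subgroup.zpow_mem _
      (Δ.gen_mem_parabolic (Set.mem_singleton _)) j)) (not_le.2 hj)
  · intro hg
    rw [isMinimal_iff]
    intro h hh
    rw [parabolic, Set.image_singleton, Subgroup.mem_closure_singleton] at hh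
    obtain ⟨k, rfl⟩ := hh
    rw [sylNorm, sylNorm, Δ.norm_mul indicator_zero]
    · exact Nat.le_add_right _ _
    · intro t ht
      rw [inversion_gen_zpow] at ht
      have : t = Δ.gen x := by
        by_contra h; rw [if_neg h] at ht; exact ht rfl
      subst this
      rw [((Commute.refl (Δ.gen x)).zpow_left k).eq, mul_inv_cancel_right, hg]

theorem parabolic_mono {X Y : Set V} (h : X ⊆ Y) : Δ.parabolic X ≤ Δ.parabolic Y :=
  Subgroup.closure_mono (Set.image_mono h)

theorem IsMinimal.mono {X Y : Set V} (h : X ⊆ Y) {g : Δ.DyerGroup} (hg : Δ.IsMinimal Y g) :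
    Δ.IsMinimal X g := fun u hu => hg u (Δ.parabolic_mono h hu)

/-- An element is `X`-minimal exactly if no vertex of `X` is a right descent: the last syllable of
the `D_X`-part of a nonminimal element is a descent. -/
theorem isMinimal_iff_forall {X : Set V} {g : Δ.DyerGroup} :
    Δ.IsMinimal X g ↔ ∀ x ∈ X, Δ.inversion g (Δ.gen x) = 0 := by
  constructor
  · intro hg x hx
    exact (Δ.isMinimal_singleton_iff).1 (IsMinimal.mono Δ (Set.singleton_subset_iff.2 hx) hg)
  · intro hg
    obtain ⟨a, h, ha, hh, rfl⟩ := Δ.exists_isMinimal_mul X g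
    obtain ⟨w, hX, -, rfl, hl, -⟩ := Δ.exists_word hh
    rcases w.eq_nil_or_concat with rfl | ⟨w, p, rfl⟩
    · simpa using ha
    · exfalso
      have hp : p.1 ∈ X := hX p (by simp)
      have h1 := (Δ.isMinimal_iff).1 ((Δ.isMinimal_singleton_iff).2 (hg p.1 hp))
        (Δ.gen p.1 ^ (-p.2)) (Subgroup.zpow_mem _ (Δ.gen_mem_parabolic (Set.mem_singleton _)) _)
      have h2 : a * Δ.eval (w.concat p) * Δ.gen p.1 ^ (-p.2) = a * Δ.eval w := by
        simp [mul_assoc]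
      have hw : Δ.eval w ∈ Δ.parabolic X :=
        Δ.eval_mem_parabolic fun q hq => hX q (by simp [hq])
      rw [h2, sylNorm, sylNorm, Δ.norm_mul_of_isMinimal indicator_zero ha hh,
        Δ.norm_mul_of_isMinimal indicator_zero ha hw] at h1
      have h3 : Δ.norm indicator (Δ.eval w) ≤ w.length := Δ.sylNorm_eval_le w
      rw [sylNorm] at hl
      rw [← hl] at h1
      simp only [List.concat_eq_append, List.length_append, List.length_singleton] at h1
      omega

/-- `B_∅` consists of the elements that have every vertex as a right descent. -/
theorem mem_B_empty_iff {g : Δ.DyerGroup} :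
    g ∈ Δ.B ∅ ↔ ∀ x, Δ.inversion g (Δ.gen x) ≠ 0 := by
  simp only [B, A, Set.mem_sdiff, Set.mem_iUnion, isMinimal_iff_forall, Set.mem_ofPred_eq]
  constructor
  · rintro ⟨-, h⟩ x hx
    refine h ⟨{x}, ?_, by simpa using hx⟩
    rw [Set.empty_ssubset]; exact Set.singleton_nonempty x
  · intro h
    refine ⟨by simp, ?_⟩
    rintro ⟨Y, hY, hm⟩
    obtain ⟨y, hy⟩ := Set.empty_ssubset.1 hY
    exact h y (hm y hy)

/-! ### A linear representation and the descents of one element -/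

section Representation

open Polynomial

theorem inversion_eq_zero_of_isMinimal {X : Set V} {a t : Δ.DyerGroup}
    (ha : Δ.IsMinimal X a) (ht : t ∈ Δ.parabolic X) : Δ.inversion a t = 0 := by
  by_contra hc
  obtain ⟨j, hj, -⟩ := Δ.exists_zpow_lt hc
  exact absurd ((Δ.isMinimal_iff).1 ha _ (Subgroup.zpow_mem _ ht j)) (not_le.2 hj)

theorem inversion_mul_of_isMinimal {X : Set V} {a h t : Δ.DyerGroup}
    (ha : Δ.IsMinimal X a) (hh : h ∈ Δ.parabolic X) (ht : t ∈ Δ.parabolic X) :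
    Δ.inversion (a * h) t = Δ.inversion h t := by
  rw [inversion_mul, Δ.inversion_eq_zero_of_isMinimal ha, add_zero]
  exact mul_mem (mul_mem hh ht) (inv_mem hh)

theorem sylNorm_inv (g : Δ.DyerGroup) : Δ.sylNorm g⁻¹ = Δ.sylNorm g := by
  have h : ∀ t, indicator (Δ.inversion g⁻¹ t) = indicator (Δ.inversion g (g⁻¹ * t * g)) := by
    intro t
    rw [inversion_inv]
    classical exact if_congr neg_eq_zero rfl rfl
  simp only [sylNorm, norm, h]
  have := finsum_comp_equiv (MulAut.conj g⁻¹).toEquiv (f := fun t => indicator (Δ.inversion g t))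
  rw [← this]
  simp

/-- There is a unit of `ℂ` of order exactly `n` (of infinite order for `n = 0`). -/
theorem exists_unit_zpow_eq_one_iff (n : ℕ) :
    ∃ ζ : ℂˣ, ∀ k : ℤ, ζ ^ k = 1 ↔ (n : ℤ) ∣ k := by
  rcases Nat.eq_zero_or_pos n with rfl | hn
  · refine ⟨Units.mk0 2 two_ne_zero, fun k => ?_⟩
    rw [Nat.cast_zero, zero_dvd_iff]
    constructor
    · intro h
      have h1 : (2 : ℂ) ^ k = 1 := by simpa using congrArg Units.val h
      have h2 : (2 : ℝ) ^ k = 1 := Complex.ofReal_injective (by push_cast; exact h1)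
      exact (zpow_eq_one_iff_right₀ (by norm_num) (by norm_num)).1 h2
    · rintro rfl; simp
  · have h := Complex.isPrimitiveRoot_exp n hn.ne'
    refine ⟨(h.isUnit hn.ne').unit, fun k => ?_⟩
    exact (IsPrimitiveRoot.isUnit_unit hn.ne' h).zpow_eq_one_iff_dvd k

/-- A chosen unit of `ℂ` of order exactly `n`. -/
noncomputable def rootUnit (n : ℕ) : ℂˣ := (exists_unit_zpow_eq_one_iff n).choose

theorem rootUnit_zpow_eq_one_iff {n : ℕ} {k : ℤ} : rootUnit n ^ k = 1 ↔ (n : ℤ) ∣ k :=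
  (exists_unit_zpow_eq_one_iff n).choose_spec k

theorem rootUnit_two : ((rootUnit 2 : ℂˣ) : ℂ) = -1 := by
  have h1 : rootUnit 2 ^ (2 : ℤ) = 1 := rootUnit_zpow_eq_one_iff.2 (by norm_num)
  have h2 : rootUnit 2 ^ (1 : ℤ) ≠ 1 := fun h => by
    have := rootUnit_zpow_eq_one_iff.1 h
    omega
  rw [zpow_one] at h2
  have h3 : ((rootUnit 2 : ℂˣ) : ℂ) ^ 2 = 1 := by
    have := congrArg Units.val h1
    simpa using this
  rw [pow_two] at h3
  rcases mul_self_eq_one_iff.1 h3 with h | h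
  · exact absurd (Units.ext h) h2
  · exact h

open Classical in
/-- The bilinear form of the representation: the usual `-cos (π / m)` for edges, and an
indeterminate for pairs of distinct vertices that are not adjacent. -/
noncomputable def form (u v : V) : ℂ[X] :=
  if u = v then 1 else
    if Δ.graph.Adj u v then C (-Complex.cos (Real.pi / Δ.m s(u, v))) else X

theorem form_self (u : V) : Δ.form u u = 1 := by simp [form]

theorem form_of_adj {u v : V} (h : Δ.graph.Adj u v) :
    Δ.form u v = C (-Complex.cos (Real.pi / Δ.m s(u, v))) := by
  rw [form, if_neg h.ne, if_pos h]

theorem form_of_not_adj {u v : V} (hne : u ≠ v) (h : ¬ Δ.graph.Adj u v) : Δ.form u v = X := by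
  rw [form, if_neg hne, if_neg h]

/-- The linear form `v ↦ (e_u, v)`. -/
noncomputable def coroot (u : V) : (V →₀ ℂ[X]) →ₗ[ℂ[X]] ℂ[X] :=
  Finsupp.linearCombination ℂ[X] (Δ.form u)

/-- The basis vector `e_u`. -/
noncomputable def root (u : V) : V →₀ ℂ[X] := Finsupp.single u 1

theorem coroot_root (u v : V) : Δ.coroot u (root v) = Δ.form u v := by
  simp [coroot, root]

/-- The complex reflection with root `e_u` and eigenvalue `μ`, multiplicatively in `μ`. -/
noncomputable def reflectionHom (u : V) : ℂ →* Module.End ℂ[X] (V →₀ ℂ[X]) where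
  toFun μ := 1 + (C (μ - 1)) • (Δ.coroot u).smulRight (root u)
  map_one' := by simp
  map_mul' μ ν := by
    ext1 v
    ext1
    simp only [LinearMap.comp_apply, Module.End.mul_apply, LinearMap.add_apply,
      Module.End.one_apply, LinearMap.smul_apply, LinearMap.smulRight_apply, map_add, map_smul,
      coroot_root, form_self, C_sub, C_mul, map_one]
    module

theorem reflectionHom_apply (u : V) (μ : ℂ) (v : V →₀ ℂ[X]) :
    Δ.reflectionHom u μ v = v + C (μ - 1) • (Δ.coroot u v • root u) := by
  simp [reflectionHom]

/-- The complex reflection with root `e_u` as an automorphism. -/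
noncomputable def reflectionEquiv (u : V) : ℂˣ →* ((V →₀ ℂ[X]) ≃ₗ[ℂ[X]] (V →₀ ℂ[X])) :=
  (LinearMap.GeneralLinearGroup.generalLinearEquiv ℂ[X] (V →₀ ℂ[X])).toMonoidHom.comp
    (Units.map (Δ.reflectionHom u))

theorem reflectionEquiv_apply (u : V) (μ : ℂˣ) (v : V →₀ ℂ[X]) :
    Δ.reflectionEquiv u μ v = v + C ((μ : ℂ) - 1) • (Δ.coroot u v • root u) := by
  rw [← reflectionHom_apply]
  rfl

open Polynomial.Chebyshev in
theorem eval_S_two_mul_cos_eq_zero {k : ℕ} (hk : 2 ≤ k) :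
    (S ℂ ((k : ℤ) - 1)).eval (2 * Complex.cos (Real.pi / k)) = 0 := by
  have h0 : (k : ℂ) ≠ 0 := by exact_mod_cast (by omega : k ≠ 0)
  have h := S_two_mul_complex_cos (Real.pi / k : ℂ) ((k : ℤ) - 1)
  have h1 : Complex.sin (Real.pi / k) ≠ 0 := by
    have : Real.sin (Real.pi / k) ≠ 0 := by
      apply (Real.sin_pos_of_pos_of_lt_pi _ _).ne'
      · have := Real.pi_pos; positivity
      · apply div_lt_self Real.pi_pos
        exact_mod_cast (by omega : 1 < k)
    exact_mod_cast this
  have h2 : (((k : ℤ) - 1 : ℤ) + 1 : ℂ) * (Real.pi / k) = Real.pi := by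
    push_cast
    field_simp
    ring
  rw [h2, Complex.sin_pi] at h
  exact (mul_eq_zero.1 h).resolve_right h1

open Polynomial.Chebyshev in
theorem eval_S_add_eval_S_eq_zero {k : ℕ} (hk : 1 ≤ k) :
    (S ℂ (k : ℤ)).eval (2 * Complex.cos (2 * Real.pi / (2 * k + 1))) +
      (S ℂ ((k : ℤ) - 1)).eval (2 * Complex.cos (2 * Real.pi / (2 * k + 1))) = 0 := by
  have h0 : (2 * k + 1 : ℂ) ≠ 0 := by exact_mod_cast (by omega : 2 * k + 1 ≠ 0)
  have h := S_two_mul_complex_cos (2 * Real.pi / (2 * k + 1) : ℂ) (k : ℤ)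
  have h' := S_two_mul_complex_cos (2 * Real.pi / (2 * k + 1) : ℂ) ((k : ℤ) - 1)
  have h1 : Complex.sin (2 * Real.pi / (2 * k + 1)) ≠ 0 := by
    have : Real.sin (2 * Real.pi / (2 * k + 1)) ≠ 0 := by
      apply (Real.sin_pos_of_pos_of_lt_pi _ _).ne'
      · have := Real.pi_pos; positivity
      · rw [div_lt_iff₀ (by positivity)]
        have h2 : (1 : ℝ) ≤ k := by exact_mod_cast hk
        nlinarith [Real.pi_pos]
    exact_mod_cast this
  have h2 : ((k : ℤ) + 1 : ℂ) * (2 * Real.pi / (2 * k + 1)) =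
      2 * Real.pi - (((k : ℤ) - 1 : ℤ) + 1 : ℂ) * (2 * Real.pi / (2 * k + 1)) := by
    have hθ := div_mul_cancel₀ (2 * Real.pi : ℂ) h0
    push_cast
    linear_combination hθ
  rw [h2, Complex.sin_two_pi_sub, ← h'] at h
  have h3 := eq_neg_iff_add_eq_zero.1 h
  rw [← add_mul] at h3
  exact (mul_eq_zero.1 h3).resolve_right h1

open Polynomial.Chebyshev in
/-- Two reflections whose roots pair to `4 cos² (π / m)` satisfy the braid relation of length `m`. -/
theorem reflection_mul_reflection_pow_eq_one {M : Type*} [AddCommGroup M] [Module ℂ[X] M]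
    {f g : Module.Dual ℂ[X] M} {x y : M} (hf : f x = 2) (hg : g y = 2) {m : ℕ} (hm : 2 < m)
    (hfg : f y * g x = C (4 * Complex.cos (Real.pi / m) ^ 2)) :
    (Module.reflection hf * Module.reflection hg) ^ m = 1 := by
  ext1 z
  have h0 : (m : ℂ) ≠ 0 := by exact_mod_cast (by omega : m ≠ 0)
  have ht : f y * g x - 2 = C (2 * Complex.cos (2 * (Real.pi / m))) := by
    rw [hfg, Complex.cos_two_mul, show (2 : ℂ[X]) = C 2 from rfl, ← C_sub]
    congr 1; ring
  have hS : ∀ n : ℤ, ∀ r : ℂ, (S ℂ[X] n).eval (C r) = C ((S ℂ n).eval r) := by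
    intro n r
    rw [← map_S (C : ℂ →+* ℂ[X]), eval_map, eval₂_hom]
  rw [Module.reflection_mul_reflection_pow_apply hf hg m z _ rfl, ht]
  simp only [hS, ← C_add]
  obtain ⟨k, rfl | rfl⟩ := Nat.even_or_odd' m
  · have e1 : ((2 * k : ℕ) - 2 : ℤ) / 2 = (k : ℤ) - 1 := by omega
    have e2 : ((2 * k : ℕ) - 1 : ℤ) / 2 = (k : ℤ) - 1 := by omega
    have e3 : (2 * (Real.pi / (2 * k : ℕ)) : ℂ) = Real.pi / k := by
      push_cast at h0 ⊢
      field_simp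
    rw [e1, e2, e3, eval_S_two_mul_cos_eq_zero (by omega)]
    simp
  · have e1 : ((2 * k + 1 : ℕ) - 2 : ℤ) / 2 = (k : ℤ) - 1 := by omega
    have e2 : ((2 * k + 1 : ℕ) - 1 : ℤ) / 2 = (k : ℤ) := by omega
    have e4 : ((2 * k + 1 : ℕ) - 3 : ℤ) / 2 = (k : ℤ) - 1 := by omega
    have e5 : ((2 * k + 1 : ℕ) : ℤ) / 2 = (k : ℤ) := by omega
    have e3 : (2 * (Real.pi / (2 * k + 1 : ℕ)) : ℂ) = 2 * Real.pi / (2 * k + 1) := by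
      push_cast
      ring
    rw [e1, e2, e4, e5, e3, eval_S_add_eval_S_eq_zero (by omega)]
    simp

/-- The representation of the Dyer group on `V →₀ ℂ[X]` by complex reflections. -/
noncomputable def rep : Δ.DyerGroup →* ((V →₀ ℂ[X]) ≃ₗ[ℂ[X]] (V →₀ ℂ[X])) := by
  refine Δ.lift (fun u => Δ.reflectionEquiv u (rootUnit (Δ.ord u))) ?_ ?_ ?_
  · intro u
    rw [← map_pow, ← zpow_natCast, rootUnit_zpow_eq_one_iff.2 (dvd_refl _), map_one]
  · intro u v huv hm
    have h1 : Δ.form u v = 0 := by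
      rw [Δ.form_of_adj huv, hm]
      simp
    have h2 : Δ.form v u = 0 := by
      rw [Δ.form_of_adj huv.symm, Sym2.eq_swap, hm]
      simp
    refine LinearEquiv.ext fun z => ?_
    rw [LinearEquiv.mul_apply, LinearEquiv.mul_apply]
    simp only [reflectionEquiv_apply, map_add, map_smul, coroot_root, h1,
      h2, zero_smul, smul_zero, add_zero]
    exact add_right_comm _ _ _
  · intro u v huv hu hv hm
    have key : ∀ w ∈ Δ.V2, ∃ h : (C (2 : ℂ) • Δ.coroot w) (root w) = 2,
        Δ.reflectionEquiv w (rootUnit (Δ.ord w)) = Module.reflection h := by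
      intro w hw
      have h : (C (2 : ℂ) • Δ.coroot w) (root w) = 2 := by
        rw [LinearMap.smul_apply, coroot_root, form_self, smul_eq_mul, mul_one]
        rfl
      refine ⟨h, ?_⟩
      ext1 z
      rw [reflectionEquiv_apply, Module.reflection_apply, (Δ.ord_eq_two_iff).2 hw, rootUnit_two,
        LinearMap.smul_apply, smul_smul, smul_eq_mul, sub_eq_add_neg z, ← neg_smul, ← neg_mul,
        ← C_neg]
      congr 4
      norm_num
    obtain ⟨hf, h1⟩ := key u hu
    obtain ⟨hg, h2⟩ := key v hv
    rw [h1, h2]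
    apply reflection_mul_reflection_pow_eq_one hf hg hm
    rw [LinearMap.smul_apply, LinearMap.smul_apply, coroot_root, coroot_root, Δ.form_of_adj huv,
      Δ.form_of_adj huv.symm, Sym2.eq_swap, smul_eq_mul, ← C_mul, ← C_mul]
    congr 1
    ring

theorem rep_gen_zpow (u : V) (k : ℤ) :
    Δ.rep (Δ.gen u ^ k) = Δ.reflectionEquiv u (rootUnit (Δ.ord u) ^ k) := by
  rw [map_zpow, map_zpow, rep, lift_gen]

/-- The ping-pong step: if the coordinate at `y` dominates, then a nontrivial power of `x` makes
the coordinate at `x` dominate. -/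
theorem exists_degree_lt {x y : V} (hne : x ≠ y) (hxy : ¬ Δ.graph.Adj x y) {k : ℤ}
    (hk : ¬ (Δ.ord x : ℤ) ∣ k) {p q : ℂ[X]} (hq : q ≠ 0) (hpq : p.degree ≤ q.degree) :
    ∃ p' : ℂ[X], q.degree < p'.degree ∧
      Δ.rep (Δ.gen x ^ k) (p • root x + q • root y) = p' • root x + q • root y := by
  set μ := rootUnit (Δ.ord x) ^ k with hμ
  have hμ1 : (μ : ℂ) - 1 ≠ 0 := by
    rw [sub_ne_zero]
    intro h
    exact hk (rootUnit_zpow_eq_one_iff.1 (Units.ext h))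
  refine ⟨C (μ : ℂ) * p + C ((μ : ℂ) - 1) * (X * q), ?_, ?_⟩
  · have h1 : (C ((μ : ℂ) - 1) * (X * q)).degree = q.degree + 1 := by
      rw [degree_C_mul hμ1, mul_comm, degree_mul_X]
    have h2 : q.degree < q.degree + 1 := by
      rw [degree_eq_natDegree hq]
      exact_mod_cast Nat.lt_succ_self _
    have h3 : (C (μ : ℂ) * p).degree < (C ((μ : ℂ) - 1) * (X * q)).degree := by
      rw [h1, degree_C_mul μ.ne_zero]
      exact hpq.trans_lt h2
    rw [degree_add_eq_right_of_degree_lt h3, h1]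
    exact h2
  · rw [rep_gen_zpow, reflectionEquiv_apply, ← hμ]
    simp only [map_add, map_smul, coroot_root, form_self, Δ.form_of_not_adj hne hxy, C_sub,
      smul_eq_mul, map_one]
    module

/-- A word of least syllable length in two nonadjacent letters maps `e_x + e_y` to a vector whose
dominating coordinate is the one at the first letter. -/
theorem exists_rep_eval {x y : V} (hne : x ≠ y) (hxy : ¬ Δ.graph.Adj x y) (w : List (V × ℤ))
    (hX : ∀ p ∈ w, p.1 = x ∨ p.1 = y) (hw : Δ.sylNorm (Δ.eval w) = w.length) :
    ∃ p q : ℂ[X], Δ.rep (Δ.eval w) (root x + root y) = p • root x + q • root y ∧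
      p ≠ 0 ∧ q ≠ 0 ∧ (w.head?.map Prod.fst ≠ some x → p.degree ≤ q.degree) ∧
      (w.head?.map Prod.fst ≠ some y → q.degree ≤ p.degree) ∧
      (w.head?.map Prod.fst = some x → q.degree < p.degree) ∧
      (w.head?.map Prod.fst = some y → p.degree < q.degree) := by
  induction w with
  | nil =>
    refine ⟨1, 1, by simp, one_ne_zero, one_ne_zero, ?_⟩
    simp
  | cons r w ih =>
    obtain ⟨s, k⟩ := r
    have hle : Δ.sylNorm (Δ.eval w) = w.length := by
      apply le_antisymm (Δ.sylNorm_eval_le w)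
      obtain ⟨w', -, he, hl, -⟩ := Δ.exists_word' (Δ.eval w)
      have := Δ.sylNorm_eval_le ((s, k) :: w')
      rw [eval_cons, he, ← eval_cons Δ (s, k) w, hw] at this
      simp only [List.length_cons] at this
      omega
    have hk : ¬ (Δ.ord s : ℤ) ∣ k := by
      intro h
      rw [eval_cons, Δ.gen_zpow_of_dvd h, one_mul, hle] at hw
      simp at hw
    have hhead : w.head?.map Prod.fst ≠ some s := by
      intro h
      match w with
      | [] => simp at h
      | (s', k') :: w =>
        obtain rfl : s' = s := by simpa using h
        have := Δ.sylNorm_eval_le ((s', k + k') :: w)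
        rw [eval_cons, zpow_add, mul_assoc, ← eval_cons Δ (s', k') w,
          ← eval_cons Δ (s', k) ((s', k') :: w), hw] at this
        simp at this
    obtain ⟨p, q, he, hp, hq, h1, h2, -⟩ := ih (fun p hp => hX p (List.mem_cons_of_mem _ hp)) hle
    rcases hX (s, k) (List.mem_cons_self ..) with hs | hs
    · obtain rfl : s = x := hs
      obtain ⟨p', hlt, hp'⟩ := Δ.exists_degree_lt hne hxy hk hq (h1 hhead)
      refine ⟨p', q, ?_, ?_, hq, ?_⟩
      · rw [eval_cons, map_mul, LinearEquiv.mul_apply, he, hp']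
      · rintro rfl; simp at hlt
      · simp [hne, hlt, hlt.le]
    · obtain rfl : s = y := hs
      obtain ⟨q', hlt, hq'⟩ := Δ.exists_degree_lt hne.symm (fun h => hxy h.symm) hk hp (h2 hhead)
      refine ⟨p, q', ?_, hp, ?_, ?_⟩
      · rw [eval_cons, map_mul, LinearEquiv.mul_apply, he, add_comm, hq', add_comm]
      · rintro rfl; simp at hlt
      · simp [hne.symm, hlt, hlt.le]

/-- Two right descents of the same element are adjacent. -/
theorem adj_of_inversion_ne_zero {x y : V} (hne : x ≠ y) {g : Δ.DyerGroup}
    (hx : Δ.inversion g (Δ.gen x) ≠ 0) (hy : Δ.inversion g (Δ.gen y) ≠ 0) :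
    Δ.graph.Adj x y := by
  by_contra hxy
  obtain ⟨a, h, ha, hh, rfl⟩ := Δ.exists_isMinimal_mul {x, y} g
  have hxm : Δ.gen x ∈ Δ.parabolic {x, y} := Δ.gen_mem_parabolic (Set.mem_insert _ _)
  have hym : Δ.gen y ∈ Δ.parabolic {x, y} :=
    Δ.gen_mem_parabolic (Set.mem_insert_of_mem _ (Set.mem_singleton _))
  rw [Δ.inversion_mul_of_isMinimal ha hh hxm] at hx
  rw [Δ.inversion_mul_of_isMinimal ha hh hym] at hy
  -- A descent `s` of `h` gives a shortest word for `h⁻¹` that begins with `s`.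
  have key : ∀ s : V, (s = x ∨ s = y) → Δ.inversion h (Δ.gen s) ≠ 0 → ∃ w : List (V × ℤ),
      Δ.eval w = h⁻¹ ∧ (∀ p ∈ w, p.1 = x ∨ p.1 = y) ∧ Δ.sylNorm (Δ.eval w) = w.length ∧
      w.head?.map Prod.fst = some s := by
    intro s hs hi
    have hsm : Δ.gen s ∈ Δ.parabolic {x, y} := by rcases hs with rfl | rfl <;> assumption
    obtain ⟨j, hj, -⟩ := Δ.exists_zpow_lt hi
    obtain ⟨w, hX, -, he, hl, -⟩ :=
      Δ.exists_word (inv_mem (mul_mem hh (Subgroup.zpow_mem _ hsm j)))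
    have he' : Δ.eval ((s, j) :: w) = h⁻¹ := by
      rw [eval_cons, he]; simp
    refine ⟨(s, j) :: w, he', ?_, ?_, rfl⟩
    · intro p hp
      rcases List.mem_cons.1 hp with rfl | hp
      · exact hs
      · simpa using hX p hp
    · apply le_antisymm (Δ.sylNorm_eval_le _)
      rw [he', sylNorm_inv, List.length_cons, hl, sylNorm_inv]
      exact hj
  obtain ⟨w, he, hX, hl, hw⟩ := key x (Or.inl rfl) hx
  obtain ⟨w', he', hX', hl', hw'⟩ := key y (Or.inr rfl) hy
  obtain ⟨p, q, h1, -, -, -, -, h2, -⟩ := Δ.exists_rep_eval hne hxy w hX hl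
  obtain ⟨p', q', h1', -, -, -, -, -, h2'⟩ := Δ.exists_rep_eval hne hxy w' hX' hl'
  rw [he] at h1
  rw [he', h1] at h1'
  have hp : p = p' := by
    have := DFunLike.congr_fun h1' x
    simpa [root, hne, hne.symm] using this
  have hq : q = q' := by
    have := DFunLike.congr_fun h1' y
    simpa [root, hne, hne.symm] using this
  subst hp hq
  exact lt_asymm (h2 hw) (h2' hw')

end Representation

/-! ### Longest elements of `D_2` -/

theorem wordNorm_mul_gen_of_eq_zero {g : Δ.DyerGroup} {t : V} (ht : t ∈ Δ.V2)
    (h : Δ.inversion g (Δ.gen t) = 0) : Δ.wordNorm (g * Δ.gen t) = Δ.wordNorm g + 1 := by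
  have h1 : Δ.wordNorm (Δ.gen t) = 1 := by
    have := Δ.norm_gen_zpow absSum_zero t 1
    rw [zpow_one, absSum_zsmul_theta, (Δ.ord_eq_two_iff).2 ht] at this
    rw [wordNorm, this]
    rfl
  rw [wordNorm, Δ.norm_mul_of_isMinimal absSum_zero ((Δ.isMinimal_singleton_iff).2 h)
    (Δ.gen_mem_parabolic (Set.mem_singleton _))]
  exact congrArg _ h1

theorem wordNorm_mul_gen_of_ne_zero {g : Δ.DyerGroup} {t : V} (ht : t ∈ Δ.V2)
    (h : Δ.inversion g (Δ.gen t) ≠ 0) : Δ.wordNorm (g * Δ.gen t) < Δ.wordNorm g := by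
  obtain ⟨j, -, hj⟩ := Δ.exists_zpow_lt h
  have h2 : Δ.gen t ^ (2 : ℤ) = 1 := by
    rw [zpow_two, Δ.gen_mul_self ht]
  obtain ⟨k, rfl | rfl⟩ := Int.even_or_odd' j
  · rw [zpow_mul, h2, one_zpow, mul_one] at hj
    exact absurd hj (lt_irrefl _)
  · rwa [zpow_add, zpow_mul, h2, one_zpow, one_mul, zpow_one] at hj

theorem wordNorm_mul_gen_lt_iff {g : Δ.DyerGroup} {t : V} (ht : t ∈ Δ.V2) :
    Δ.wordNorm (g * Δ.gen t) < Δ.wordNorm g ↔ Δ.inversion g (Δ.gen t) ≠ 0 := by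
  refine ⟨fun h h0 => ?_, Δ.wordNorm_mul_gen_of_ne_zero ht⟩
  rw [Δ.wordNorm_mul_gen_of_eq_zero ht h0] at h
  omega

theorem wordNorm_inv (g : Δ.DyerGroup) : Δ.wordNorm g⁻¹ = Δ.wordNorm g := by
  have key : ∀ g : Δ.DyerGroup, Δ.wordNorm g⁻¹ ≤ Δ.wordNorm g := by
    intro g
    obtain ⟨w, -, rfl, -, hw⟩ := Δ.exists_word' g
    have h1 : ∀ w : List (V × ℤ), ∃ w' : List (V × ℤ), weight w' = weight w ∧
        Δ.eval w' = (Δ.eval w)⁻¹ := by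
      intro w
      induction w with
      | nil => exact ⟨[], rfl, by simp⟩
      | cons p w ih =>
        obtain ⟨w', h1, h2⟩ := ih
        exact ⟨w' ++ [(p.1, -p.2)], by simp [h1, add_comm], by simp [h2]⟩
    obtain ⟨w', h2, h3⟩ := h1 w
    rw [← hw, ← h3, ← h2]
    exact Δ.wordNorm_eval_le w'
  exact le_antisymm (key g) (by simpa using key g⁻¹)

open Classical in
/-- The right Demazure operator `g ↦ max (g, g t)`, where the longer element is the greater. -/
noncomputable def demazureRight (t : V) (g : Δ.DyerGroup) : Δ.DyerGroup :=
  if Δ.inversion g (Δ.gen t) = 0 then g * Δ.gen t else g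

open Classical in
/-- The left Demazure operator `g ↦ max (g, s g)`, where the longer element is the greater. -/
noncomputable def demazureLeft (s : V) (g : Δ.DyerGroup) : Δ.DyerGroup :=
  if Δ.inversion g⁻¹ (Δ.gen s) = 0 then Δ.gen s * g else g

theorem demazureLeft_eq {s : V} (hs : s ∈ Δ.V2) (g : Δ.DyerGroup) :
    Δ.demazureLeft s g = (Δ.demazureRight s g⁻¹)⁻¹ := by
  rw [demazureLeft, demazureRight]
  split_ifs
  · rw [mul_inv_rev, inv_inv, Δ.gen_inv hs]
  · rw [inv_inv]

/-- Multiplication by `s` on the left does not affect whether `t` is a right descent, unless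
`s g = g t`. -/
theorem inversion_gen_mul {s t : V} {g : Δ.DyerGroup}
    (h : g * Δ.gen t * g⁻¹ ≠ Δ.gen s) :
    Δ.inversion (Δ.gen s * g) (Δ.gen t) = Δ.inversion g (Δ.gen t) := by
  rw [inversion_mul, inversion_gen, if_neg h, add_zero]

theorem inversion_inv_mul_gen {s t : V} (ht : t ∈ Δ.V2) {g : Δ.DyerGroup}
    (h : g * Δ.gen t * g⁻¹ ≠ Δ.gen s) :
    Δ.inversion (g * Δ.gen t)⁻¹ (Δ.gen s) = Δ.inversion g⁻¹ (Δ.gen s) := by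
  rw [mul_inv_rev, Δ.gen_inv ht, inversion_gen_mul]
  intro hc
  apply h
  rw [← hc]; group

theorem demazureLeft_demazureRight {s t : V} (hs : s ∈ Δ.V2) (ht : t ∈ Δ.V2) (g : Δ.DyerGroup) :
    Δ.demazureLeft s (Δ.demazureRight t g) = Δ.demazureRight t (Δ.demazureLeft s g) := by
  by_cases h : g * Δ.gen t * g⁻¹ = Δ.gen s
  · have e : Δ.gen s * g = g * Δ.gen t := by rw [← h]; group
    have e' : Δ.inversion g⁻¹ (Δ.gen s) = 0 ↔ Δ.inversion g (Δ.gen t) = 0 := by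
      rw [inversion_inv, neg_eq_zero, ← h]
      have : g⁻¹ * (g * Δ.gen t * g⁻¹) * g = Δ.gen t := by group
      rw [this]
    by_cases h0 : Δ.inversion g (Δ.gen t) = 0
    · have h1 : Δ.inversion (g * Δ.gen t) (Δ.gen t) ≠ 0 := by
        rw [← Δ.wordNorm_mul_gen_lt_iff ht, mul_assoc, Δ.gen_mul_self ht, mul_one,
          Δ.wordNorm_mul_gen_of_eq_zero ht h0]
        omega
      have h2 : Δ.inversion (g * Δ.gen t)⁻¹ (Δ.gen s) ≠ 0 := by
        rw [← e, mul_inv_rev, Δ.gen_inv hs, ← Δ.wordNorm_mul_gen_lt_iff hs, mul_assoc,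
          Δ.gen_mul_self hs, mul_one, Δ.wordNorm_mul_gen_of_eq_zero hs (e'.2 h0)]
        omega
      rw [demazureRight, if_pos h0, demazureLeft, if_neg h2, demazureLeft, if_pos (e'.2 h0), e,
        demazureRight, if_neg h1]
    · rw [demazureRight, if_neg h0, demazureLeft, if_neg (mt e'.1 h0), demazureRight, if_neg h0]
  · have h1 := Δ.inversion_gen_mul h
    have h2 := Δ.inversion_inv_mul_gen ht h
    by_cases h3 : Δ.inversion g (Δ.gen t) = 0 <;>
    by_cases h4 : Δ.inversion g⁻¹ (Δ.gen s) = 0 <;>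
    simp only [demazureRight, demazureLeft, h1, h2, h3, h4, if_true, if_false, mul_assoc]

/-- Every element of `D_2` is obtained from `1` by right Demazure operators. -/
theorem exists_foldr_demazureRight {u : Δ.DyerGroup} (hu : u ∈ Δ.parabolic Δ.V2) :
    ∃ L : List V, (∀ t ∈ L, t ∈ Δ.V2) ∧ L.foldr Δ.demazureRight 1 = u := by
  induction hn : Δ.wordNorm u using Nat.strong_induction_on generalizing u with
  | _ n ih =>
    by_cases h : ∀ t ∈ Δ.V2, Δ.inversion u (Δ.gen t) = 0
    · have h1 := (Δ.isMinimal_iff).1 ((Δ.isMinimal_iff_forall).2 h) u⁻¹ (inv_mem hu)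
      rw [mul_inv_cancel, sylNorm, sylNorm, Δ.norm_one indicator_zero] at h1
      rw [Δ.eq_one_of_sylNorm_eq_zero (Nat.le_zero.1 h1)]
      exact ⟨[], by simp, rfl⟩
    · push Not at h
      obtain ⟨t, ht, h⟩ := h
      have hlt := Δ.wordNorm_mul_gen_of_ne_zero ht h
      obtain ⟨L, hL, he⟩ := ih _ (hn ▸ hlt) (mul_mem hu (Δ.gen_mem_parabolic ht)) rfl
      refine ⟨t :: L, ?_, ?_⟩
      · intro r hr
        rcases List.mem_cons.1 hr with rfl | hr
        · exact ht
        · exact hL r hr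
      · have h0 : Δ.inversion (u * Δ.gen t) (Δ.gen t) = 0 := by
          by_contra hc
          rw [← ne_eq, ← Δ.wordNorm_mul_gen_lt_iff ht, mul_assoc, Δ.gen_mul_self ht, mul_one] at hc
          omega
        rw [List.foldr_cons, he, demazureRight, if_pos h0, mul_assoc, Δ.gen_mul_self ht, mul_one]

theorem foldr_demazureLeft {L : List V} (hL : ∀ t ∈ L, t ∈ Δ.V2) (g : Δ.DyerGroup) :
    L.foldr Δ.demazureLeft g = (L.foldr Δ.demazureRight g⁻¹)⁻¹ := by
  induction L with
  | nil => simp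
  | cons s L ih =>
    rw [List.foldr_cons, List.foldr_cons, ih fun t ht => hL t (List.mem_cons_of_mem _ ht),
      Δ.demazureLeft_eq (hL s (List.mem_cons_self ..)), inv_inv]

theorem foldr_demazureLeft_comm {L L' : List V} (hL : ∀ t ∈ L, t ∈ Δ.V2)
    (hL' : ∀ t ∈ L', t ∈ Δ.V2) (g : Δ.DyerGroup) :
    L.foldr Δ.demazureLeft (L'.foldr Δ.demazureRight g) =
      L'.foldr Δ.demazureRight (L.foldr Δ.demazureLeft g) := by
  have one : ∀ s ∈ Δ.V2, ∀ L' : List V, (∀ t ∈ L', t ∈ Δ.V2) → ∀ g : Δ.DyerGroup,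
      Δ.demazureLeft s (L'.foldr Δ.demazureRight g) =
        L'.foldr Δ.demazureRight (Δ.demazureLeft s g) := by
    intro s hs L' hL' g
    induction L' with
    | nil => rfl
    | cons t L' ih =>
      rw [List.foldr_cons, List.foldr_cons,
        Δ.demazureLeft_demazureRight hs (hL' t (List.mem_cons_self ..)),
        ih fun t ht => hL' t (List.mem_cons_of_mem _ ht)]
  induction L with
  | nil => rfl
  | cons s L ih =>
    rw [List.foldr_cons, List.foldr_cons, ih fun t ht => hL t (List.mem_cons_of_mem _ ht),
      one s (hL s (List.mem_cons_self ..)) L' hL']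

theorem wordNorm_foldr_demazureRight {L : List V} (hL : ∀ t ∈ L, t ∈ Δ.V2) (g : Δ.DyerGroup) :
    L.foldr Δ.demazureRight g = g ∨ Δ.wordNorm g < Δ.wordNorm (L.foldr Δ.demazureRight g) := by
  induction L with
  | nil => exact Or.inl rfl
  | cons t L ih =>
    have ih := ih fun t ht => hL t (List.mem_cons_of_mem _ ht)
    rw [List.foldr_cons, demazureRight]
    split_ifs with h
    · right
      rw [Δ.wordNorm_mul_gen_of_eq_zero (hL t (List.mem_cons_self ..)) h]
      rcases ih with ih | ih
      · rw [ih]; omega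
      · omega
    · exact ih

/-- An element of `D_2` with all vertices of `V_2` as right descents is strictly longer than every
other element of `D_2`: with `w = λ 1` for a product `λ` of left operators, and `u = ρ 1` for a
product `ρ` of right operators, `w = ρ w = ρ (λ 1) = λ (ρ 1) = λ u`. -/
theorem eq_or_wordNorm_lt {w u : Δ.DyerGroup} (hw : w ∈ Δ.parabolic Δ.V2)
    (hd : ∀ s ∈ Δ.V2, Δ.inversion w (Δ.gen s) ≠ 0) (hu : u ∈ Δ.parabolic Δ.V2) :
    u = w ∨ Δ.wordNorm u < Δ.wordNorm w := by
  obtain ⟨L', hL', rfl⟩ := Δ.exists_foldr_demazureRight hu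
  obtain ⟨L, hL, he⟩ := Δ.exists_foldr_demazureRight (inv_mem hw)
  have h1 : L.foldr Δ.demazureLeft 1 = w := by
    rw [Δ.foldr_demazureLeft hL, inv_one, he, inv_inv]
  have h2 : L'.foldr Δ.demazureRight w = w := by
    clear hu
    induction L' with
    | nil => rfl
    | cons t L' ih =>
      rw [List.foldr_cons, ih fun t ht => hL' t (List.mem_cons_of_mem _ ht), demazureRight,
        if_neg (hd t (hL' t (List.mem_cons_self ..)))]
  have h3 : L.foldr Δ.demazureLeft (L'.foldr Δ.demazureRight 1) = w := by
    rw [Δ.foldr_demazureLeft_comm hL hL', h1, h2]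
  rw [Δ.foldr_demazureLeft hL] at h3
  rcases Δ.wordNorm_foldr_demazureRight hL (L'.foldr Δ.demazureRight 1)⁻¹ with h | h
  · left
    rw [← h3, h, inv_inv]
  · right
    rw [wordNorm_inv] at h
    rw [← h3, wordNorm_inv]
    exact h

theorem finite_setOf_wordNorm_le [Finite V] (n : ℕ) :
    {g : Δ.DyerGroup | Δ.wordNorm g ≤ n}.Finite := by
  have key : ∀ w : List (V × ℤ), ∃ l : List (V × Bool), l.length = weight w ∧
      (l.map fun p => if p.2 then Δ.gen p.1 else (Δ.gen p.1)⁻¹).prod = Δ.eval w := by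
    intro w
    induction w with
    | nil => exact ⟨[], rfl, rfl⟩
    | cons p w ih =>
      obtain ⟨l, hl, he⟩ := ih
      obtain ⟨n, hn⟩ := p.2.eq_nat_or_neg
      rcases hn with hn | hn
      · exact ⟨List.replicate n (p.1, true) ++ l, by simp [hn, hl], by simp [he, hn]⟩
      · exact ⟨List.replicate n (p.1, false) ++ l, by simp [hn, hl], by simp [he, hn]⟩
  refine ((List.finite_length_le (V × Bool) n).image fun l =>
    (l.map fun p => if p.2 then Δ.gen p.1 else (Δ.gen p.1)⁻¹).prod).subset ?_
  intro g hg
  obtain ⟨w, -, rfl, -, hw⟩ := Δ.exists_word' g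
  obtain ⟨l, hl, he⟩ := key w
  refine ⟨l, ?_, he⟩
  have : Δ.wordNorm (Δ.eval w) ≤ n := hg
  change l.length ≤ n
  omega

/-! ### Elements with all vertices as descents -/

theorem exponent_conj (x : V) (hx : x ∉ Δ.V2) (v t : Δ.DyerGroup) :
    Δ.exponent x hx (v⁻¹ * t * v) = Δ.exponent x hx t := by
  rw [map_mul, map_mul, map_inv, mul_comm, mul_inv_cancel_left]

/-- The reason is that a generator `x ∉ V_2` is not conjugate to any other generator. -/
theorem inversion_gen_eq_zero_of_notMem {Y : Set V} {h : Δ.DyerGroup} (hh : h ∈ Δ.parabolic Y)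
    {x : V} (hx : x ∉ Δ.V2) (hxY : x ∉ Y) : Δ.inversion h (Δ.gen x) = 0 := by
  by_contra hc
  obtain ⟨y, hy, v, -, he⟩ := Δ.exists_conj_of_inversion_ne_zero hh hc
  apply Δ.exponent_gen_self_ne_one x hx
  rw [he, exponent_conj, Δ.exponent_gen_of_ne]
  rintro rfl
  exact hxY hy

theorem inversion_gen_eq_zero_of_mem_V2 {h : Δ.DyerGroup} (hh : h ∈ Δ.parabolic Δ.V2ᶜ)
    {s : V} (hs : s ∈ Δ.V2) : Δ.inversion h (Δ.gen s) = 0 := by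
  by_contra hc
  obtain ⟨y, hy, v, -, he⟩ := Δ.exists_conj_of_inversion_ne_zero hh hc
  apply Δ.exponent_gen_self_ne_one y hy
  rw [← Δ.exponent_conj y hy v, ← he, Δ.exponent_gen_of_ne]
  rintro rfl
  exact hy hs

/-- If the graph is complete, then the generators outside `V_2` are central. -/
theorem commute_gen_of_eq_top (hG : Δ.graph = ⊤) {x : V} (hx : x ∉ Δ.V2) (g : Δ.DyerGroup) :
    Commute (Δ.gen x) g := by
  have key : ∀ y, Commute (Δ.gen x) (Δ.gen y) := by
    intro y
    by_cases hxy : x = y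
    · rw [hxy]
    · have hadj : Δ.graph.Adj x y := by rw [hG]; exact hxy
      exact Δ.commute_gen hadj (Δ.m_eq_two_of_notMem hadj hx)
  induction g using Δ.gen_induction with
  | one => exact Commute.one_right _
  | mul y g ih => exact (key y).mul_right ih
  | inv_mul y g ih => exact (key y).inv_right.mul_right ih

/-- The product of the powers `x ^ c x` over the vertices `x` of a list. -/
def powProd (L : List V) (c : V → ℤ) : Δ.DyerGroup := (L.map fun x => Δ.gen x ^ c x).prod

@[simp] theorem powProd_nil (c : V → ℤ) : Δ.powProd [] c = 1 := rfl

@[simp] theorem powProd_cons (x : V) (L : List V) (c : V → ℤ) :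
    Δ.powProd (x :: L) c = Δ.gen x ^ c x * Δ.powProd L c := by simp [powProd]

theorem powProd_append (L L' : List V) (c : V → ℤ) :
    Δ.powProd (L ++ L') c = Δ.powProd L c * Δ.powProd L' c := by simp [powProd]

theorem powProd_congr {L : List V} {c d : V → ℤ} (h : ∀ x ∈ L, c x = d x) :
    Δ.powProd L c = Δ.powProd L d := by
  rw [powProd, powProd]
  congr 1
  exact List.map_congr_left fun x hx => by rw [h x hx]

theorem powProd_mem_parabolic {Y : Set V} {L : List V} {c : V → ℤ}
    (h : ∀ x ∈ L, x ∈ Y ∨ c x = 0) : Δ.powProd L c ∈ Δ.parabolic Y := by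
  refine Subgroup.list_prod_mem _ ?_
  simp only [List.mem_map]
  rintro _ ⟨x, hx, rfl⟩
  rcases h x hx with h | h
  · exact Subgroup.zpow_mem _ (Δ.gen_mem_parabolic h) _
  · rw [h, zpow_zero]; exact one_mem _

theorem powProd_update [DecidableEq V] (hG : Δ.graph = ⊤) {L : List V} (hL : L.Nodup) {x : V}
    (hx : x ∉ Δ.V2) (hxL : x ∈ L) (c : V → ℤ) (k : ℤ) :
    Δ.powProd L (Function.update c x (c x + k)) = Δ.powProd L c * Δ.gen x ^ k := by
  have hcomm : ∀ g, Commute (Δ.gen x ^ k) g := fun g =>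
    (Δ.commute_gen_of_eq_top hG hx g).zpow_left k
  induction L with
  | nil => simp at hxL
  | cons y L ih =>
    rw [powProd_cons, powProd_cons]
    obtain ⟨hy, hL⟩ := List.nodup_cons.1 hL
    by_cases hxy : y = x
    · subst hxy
      have h1 : Δ.powProd L (Function.update c y (c y + k)) = Δ.powProd L c :=
        Δ.powProd_congr fun z hz => Function.update_of_ne (by rintro rfl; exact hy hz) _ _
      rw [h1, Function.update_self, zpow_add, mul_assoc, (hcomm _).eq, mul_assoc]
    · rw [ih hL ((List.mem_cons.1 hxL).resolve_left fun h => hxy h.symm),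
        Function.update_of_ne hxy, mul_assoc]

theorem exists_mul_powProd (hG : Δ.graph = ⊤) {L : List V} (hL : L.Nodup)
    (hmem : ∀ x, x ∈ L ↔ x ∉ Δ.V2) (g : Δ.DyerGroup) :
    ∃ w ∈ Δ.parabolic Δ.V2, ∃ c : V → ℤ, g = w * Δ.powProd L c := by
  classical
  have key : ∀ x : V, ∀ k : ℤ, ∀ g : Δ.DyerGroup,
      (∃ w ∈ Δ.parabolic Δ.V2, ∃ c : V → ℤ, g = w * Δ.powProd L c) →
      ∃ w ∈ Δ.parabolic Δ.V2, ∃ c : V → ℤ, Δ.gen x ^ k * g = w * Δ.powProd L c := by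
    rintro x k g ⟨w, hw, c, rfl⟩
    by_cases hx : x ∈ Δ.V2
    · exact ⟨_, mul_mem (Subgroup.zpow_mem _ (Δ.gen_mem_parabolic hx) k) hw, c,
        (mul_assoc _ _ _).symm⟩
    · refine ⟨w, hw, Function.update c x (c x + k), ?_⟩
      rw [Δ.powProd_update hG hL hx ((hmem x).2 hx), ← mul_assoc w,
        ((Δ.commute_gen_of_eq_top hG hx _).zpow_left k).eq]
  induction g using Δ.gen_induction with
  | one => exact ⟨1, one_mem _, 0, by simp [powProd]⟩
  | mul x g ih => simpa using key x 1 g ih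
  | inv_mul x g ih => simpa using key x (-1) g ih

theorem inversion_mul_powProd_of_mem (hG : Δ.graph = ⊤) {L : List V}
    (hmem : ∀ x, x ∈ L ↔ x ∉ Δ.V2) (w : Δ.DyerGroup) (c : V → ℤ) {s : V} (hs : s ∈ Δ.V2) :
    Δ.inversion (w * Δ.powProd L c) (Δ.gen s) = Δ.inversion w (Δ.gen s) := by
  have h1 : Δ.powProd L c ∈ Δ.parabolic Δ.V2ᶜ :=
    Δ.powProd_mem_parabolic fun x hx => Or.inl ((hmem x).1 hx)
  have h2 : Commute (Δ.powProd L c) (Δ.gen s) := by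
    refine Commute.list_prod_left _ _ ?_
    simp only [List.mem_map]
    rintro _ ⟨x, hx, rfl⟩
    exact (Δ.commute_gen_of_eq_top hG ((hmem x).1 hx) _).zpow_left _
  rw [inversion_mul, Δ.inversion_gen_eq_zero_of_mem_V2 h1 hs, zero_add, h2.eq,
    mul_inv_cancel_right]

theorem inversion_mul_powProd_of_notMem (hG : Δ.graph = ⊤) {L : List V} (hL : L.Nodup)
    {w : Δ.DyerGroup} (hw : w ∈ Δ.parabolic Δ.V2) (c : V → ℤ) {x : V} (hx : x ∉ Δ.V2)
    (hxL : x ∈ L) :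
    Δ.inversion (w * Δ.powProd L c) (Δ.gen x) = c x • theta (Δ.ord x) := by
  classical
  have h1 : Δ.powProd L c = Δ.powProd L (Function.update c x 0) * Δ.gen x ^ c x := by
    rw [← Δ.powProd_update hG hL hx hxL]
    simp
  have h2 : w * Δ.powProd L (Function.update c x 0) ∈ Δ.parabolic {x}ᶜ := by
    refine mul_mem (Δ.parabolic_mono ?_ hw) (Δ.powProd_mem_parabolic fun y _ => ?_)
    · rintro y hy rfl
      exact hx hy
    · by_cases hyx : y = x
      · right; rw [hyx, Function.update_self]
      · left; exact hyx
  rw [h1, ← mul_assoc, inversion_mul, inversion_gen_zpow, if_pos rfl,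
    ((Commute.refl (Δ.gen x)).zpow_left (c x)).eq, mul_inv_cancel_right,
    Δ.inversion_gen_eq_zero_of_notMem h2 hx (by simp), add_zero]

theorem mem_B_empty_iff_exists (hG : Δ.graph = ⊤) {L : List V} (hL : L.Nodup)
    (hmem : ∀ x, x ∈ L ↔ x ∉ Δ.V2) (g : Δ.DyerGroup) :
    g ∈ Δ.B ∅ ↔ ∃ w ∈ Δ.parabolic Δ.V2, ∃ c : V → ℤ,
      (∀ s ∈ Δ.V2, Δ.inversion w (Δ.gen s) ≠ 0) ∧ (∀ x ∈ L, ¬ (Δ.ord x : ℤ) ∣ c x) ∧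
      g = w * Δ.powProd L c := by
  rw [mem_B_empty_iff]
  constructor
  · intro h
    obtain ⟨w, hw, c, rfl⟩ := Δ.exists_mul_powProd hG hL hmem g
    refine ⟨w, hw, c, fun s hs => ?_, fun x hx => ?_, rfl⟩
    · rw [← Δ.inversion_mul_powProd_of_mem hG hmem w c hs]
      exact h s
    · rw [← zsmul_theta_eq_zero_iff,
        ← Δ.inversion_mul_powProd_of_notMem hG hL hw c ((hmem x).1 hx) hx]
      exact h x
  · rintro ⟨w, hw, c, h1, h2, rfl⟩ x
    by_cases hx : x ∈ Δ.V2
    · rw [Δ.inversion_mul_powProd_of_mem hG hmem w c hx]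
      exact h1 x hx
    · have hxL := (hmem x).2 hx
      rw [Δ.inversion_mul_powProd_of_notMem hG hL hw c hx hxL, ne_eq, zsmul_theta_eq_zero_iff]
      exact h2 x hxL

theorem isLongestElement_iff (w : Δ.parabolic Δ.V2) :
    IsLongestElement (Δ.parabolicGens Δ.V2) w ↔
      ∀ s ∈ Δ.V2, Δ.inversion (w : Δ.DyerGroup) (Δ.gen s) ≠ 0 := by
  simp only [IsLongestElement, wordLength_parabolicGens]
  constructor
  · intro h s hs
    rw [← Δ.wordNorm_mul_gen_lt_iff hs]
    exact h ⟨Δ.gen s, Δ.gen_mem_parabolic hs⟩ (Set.mem_image_of_mem _ hs)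
  · rintro h ⟨_, _⟩ ⟨s, hs, rfl⟩
    exact (Δ.wordNorm_mul_gen_lt_iff hs).2 (h s hs)

/-- All vertices can be descents of one element only for Dyer groups of spherical type. -/
theorem isSpherical_of_mem_B [Finite V] {g : Δ.DyerGroup} (hg : g ∈ Δ.B ∅) : Δ.IsSpherical := by
  classical
  have hG : Δ.graph = ⊤ := by
    ext x y
    rw [SimpleGraph.top_adj]
    refine ⟨fun h => h.ne, fun h => ?_⟩
    rw [mem_B_empty_iff] at hg
    exact Δ.adj_of_inversion_ne_zero h (hg x) (hg y)
  refine ⟨hG, ?_⟩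
  have := Fintype.ofFinite V
  obtain ⟨w, hw, -, hd, -, -⟩ := (Δ.mem_B_empty_iff_exists hG
    (L := (Finset.univ.filter fun x => x ∉ Δ.V2).toList) (Finset.nodup_toList _) (by simp) g).1 hg
  refine ((Δ.finite_setOf_wordNorm_le (Δ.wordNorm w)).subset ?_ :
    (Δ.parabolic Δ.V2 : Set Δ.DyerGroup).Finite)
  intro u hu
  rcases Δ.eq_or_wordNorm_lt hw hd hu with h | h
  · exact le_of_eq (congrArg Δ.wordNorm h)
  · exact h.le

/-- The longest element of a finite `D_2` exists, is unique and has length `maxLength`. -/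
theorem exists_longest (h : Finite (Δ.parabolic Δ.V2)) :
    ∃ w ∈ Δ.parabolic Δ.V2, Δ.wordNorm w = Δ.maxLength ∧
      ∀ u ∈ Δ.parabolic Δ.V2, (∀ s ∈ Δ.V2, Δ.inversion u (Δ.gen s) ≠ 0) ↔ u = w := by
  have hbdd : BddAbove (Set.range fun g : Δ.parabolic Δ.V2 =>
      wordLength (Δ.parabolicGens Δ.V2) g) := (Set.finite_range _).bddAbove
  obtain ⟨w, hw⟩ := Nat.sSup_mem (Set.range_nonempty _) hbdd
  have hw' : Δ.wordNorm (w : Δ.DyerGroup) = Δ.maxLength := by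
    rw [← wordLength_parabolicGens]; exact hw
  have hmax : ∀ u ∈ Δ.parabolic Δ.V2, Δ.wordNorm u ≤ Δ.wordNorm (w : Δ.DyerGroup) := by
    intro u hu
    rw [hw', ← Δ.wordLength_parabolicGens Δ.V2 ⟨u, hu⟩]
    exact le_ciSup hbdd (⟨u, hu⟩ : Δ.parabolic Δ.V2)
  have hd : ∀ s ∈ Δ.V2, Δ.inversion (w : Δ.DyerGroup) (Δ.gen s) ≠ 0 := by
    intro s hs h0
    have h1 := Δ.wordNorm_mul_gen_of_eq_zero hs h0
    have h2 := hmax _ (mul_mem w.2 (Δ.gen_mem_parabolic hs))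
    omega
  refine ⟨w, w.2, hw', fun u hu => ⟨fun h => ?_, fun h => h ▸ hd⟩⟩
  rcases Δ.eq_or_wordNorm_lt hu h w.2 with h | h
  · exact h.symm
  · exact absurd (hmax u hu) (not_le.2 h)

end DyerGraph

/-! ### Counting series -/

/-- The series that counts the elements of a set by the values of `ℓ`. -/
noncomputable def countSeries {α : Type*} (A : Set α) (ℓ : α → ℕ) : PowerSeries ℚ :=
  PowerSeries.mk fun n => (({a | a ∈ A ∧ ℓ a = n} : Set α).ncard : ℚ)

/-- Counting series multiply along a bijection that adds the values counted. -/
theorem countSeries_mul {α β γ : Type*} {A : Set α} {B : Set β} {C : Set γ} {ℓ : α → ℕ}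
    {ℓ' : β → ℕ} {ℓ'' : γ → ℕ} (f : α → β → γ)
    (hf : Set.BijOn (fun p : α × β => f p.1 p.2) (A ×ˢ B) C)
    (hadd : ∀ a ∈ A, ∀ b ∈ B, ℓ'' (f a b) = ℓ a + ℓ' b)
    (hA : ∀ n, {a | a ∈ A ∧ ℓ a = n}.Finite) (hB : ∀ n, {b | b ∈ B ∧ ℓ' b = n}.Finite) :
    countSeries C ℓ'' = countSeries A ℓ * countSeries B ℓ' := by
  classical
  ext n
  rw [PowerSeries.coeff_mul]
  simp only [countSeries, PowerSeries.coeff_mk]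
  let P : Finset (α × β) := (Finset.HasAntidiagonal.antidiagonal n).biUnion fun ij =>
    (hA ij.1).toFinset ×ˢ (hB ij.2).toFinset
  have hP : ∀ a b, (a, b) ∈ P ↔ (a ∈ A ∧ b ∈ B) ∧ ℓ a + ℓ' b = n := by
    intro a b
    simp only [P, Finset.mem_biUnion, Finset.HasAntidiagonal.mem_antidiagonal, Finset.mem_product,
      Set.Finite.mem_toFinset]
    constructor
    · rintro ⟨ij, hij, ⟨ha, h1⟩, ⟨hb, h2⟩⟩
      exact ⟨⟨ha, hb⟩, by rw [h1, h2, hij]⟩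
    · rintro ⟨⟨ha, hb⟩, h⟩
      exact ⟨(ℓ a, ℓ' b), h, ⟨ha, rfl⟩, ⟨hb, rfl⟩⟩
  have h1 : {c | c ∈ C ∧ ℓ'' c = n} = (fun p : α × β => f p.1 p.2) '' (P : Set (α × β)) := by
    ext c
    constructor
    · rintro ⟨hc, hn⟩
      obtain ⟨⟨a, b⟩, ⟨ha, hb⟩, rfl⟩ := hf.surjOn hc
      exact ⟨(a, b), (hP a b).2 ⟨⟨ha, hb⟩, (hadd a ha b hb).symm.trans hn⟩, rfl⟩
    · rintro ⟨⟨a, b⟩, hab, rfl⟩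
      obtain ⟨⟨ha, hb⟩, hn⟩ := (hP a b).1 hab
      exact ⟨hf.mapsTo ⟨ha, hb⟩, (hadd a ha b hb).trans hn⟩
  have h2 : Set.InjOn (fun p : α × β => f p.1 p.2) (P : Set (α × β)) :=
    hf.injOn.mono fun p hp => ((hP p.1 p.2).1 hp).1
  rw [h1, h2.ncard_image, Set.ncard_coe_finset, Finset.card_biUnion]
  · push_cast
    refine Finset.sum_congr rfl fun ij _ => ?_
    rw [Finset.card_product, Set.ncard_eq_toFinset_card _ (hA ij.1),
      Set.ncard_eq_toFinset_card _ (hB ij.2)]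
    push_cast
    rfl
  · rintro ⟨i, j⟩ - ⟨i', j'⟩ - hne
    refine Finset.disjoint_left.2 ?_
    rintro ⟨a, b⟩ hab hab'
    simp only [Finset.mem_product, Set.Finite.mem_toFinset] at hab hab'
    obtain ⟨⟨-, rfl⟩, ⟨-, rfl⟩⟩ := hab
    obtain ⟨⟨-, rfl⟩, ⟨-, rfl⟩⟩ := hab'
    exact hne rfl

theorem countSeries_singleton {α : Type*} (a : α) (ℓ : α → ℕ) :
    countSeries {a} ℓ = PowerSeries.X ^ ℓ a := by
  ext n
  rw [countSeries, PowerSeries.coeff_mk, PowerSeries.coeff_X_pow]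
  split_ifs with h
  · have : {b | b ∈ ({a} : Set α) ∧ ℓ b = n} = {a} := by
      ext b
      constructor
      · exact fun h => h.1
      · rintro rfl; exact ⟨rfl, h.symm⟩
    rw [this, Set.ncard_singleton, Nat.cast_one]
  · have : {b | b ∈ ({a} : Set α) ∧ ℓ b = n} = ∅ := by
      ext b
      constructor
      · rintro ⟨rfl, hb⟩; exact h hb.symm
      · exact fun h => h.elim
    rw [this, Set.ncard_empty, Nat.cast_zero]

/-- The growth series of the nonzero elements of the cyclic group `ZMod n`, which is `ℤ` for
`n = 0`. -/
noncomputable def cyclicSeries (n : ℕ) : PowerSeries ℚ :=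
  countSeries {r : ZMod n | r ≠ 0} fun r => r.valMinAbs.natAbs

theorem eq_or_eq_neg_of_natAbs_valMinAbs_eq {n k : ℕ} {r : ZMod n}
    (h : r.valMinAbs.natAbs = k) : r = k ∨ r = -k := by
  rw [← ZMod.coe_valMinAbs r]
  rcases Int.natAbs_eq r.valMinAbs with h1 | h1
  · left; rw [h1, h]; simp
  · right; rw [h1, h]; simp

theorem finite_setOf_natAbs_valMinAbs (n k : ℕ) (A : Set (ZMod n)) :
    {r | r ∈ A ∧ r.valMinAbs.natAbs = k}.Finite := by
  refine (Set.toFinite {(k : ZMod n), -(k : ZMod n)}).subset ?_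
  rintro r ⟨-, hr⟩
  exact eq_or_eq_neg_of_natAbs_valMinAbs_eq hr

theorem coeff_cyclicSeries_zero (n : ℕ) : PowerSeries.coeff 0 (cyclicSeries n) = 0 := by
  rw [cyclicSeries, countSeries, PowerSeries.coeff_mk]
  have : {r : ZMod n | r ∈ {r : ZMod n | r ≠ 0} ∧ r.valMinAbs.natAbs = 0} = ∅ := by
    ext r
    constructor
    · rintro ⟨h, h0⟩
      exact h ((ZMod.valMinAbs_eq_zero r).1 (Int.natAbs_eq_zero.1 h0))
    · exact fun h => h.elim
  rw [this, Set.ncard_empty, Nat.cast_zero]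

theorem setOf_natAbs_valMinAbs_eq {n k : ℕ} (hk : k ≠ 0)
    (h : (k : ZMod n).valMinAbs.natAbs = k) :
    {r : ZMod n | r ∈ {r : ZMod n | r ≠ 0} ∧ r.valMinAbs.natAbs = k} =
      {(k : ZMod n), -(k : ZMod n)} := by
  have h0 : ∀ r : ZMod n, r.valMinAbs.natAbs = k → r ≠ 0 := by
    rintro r hr rfl
    rw [ZMod.valMinAbs_zero] at hr
    exact hk hr.symm
  ext r
  constructor
  · rintro ⟨-, hr⟩
    exact eq_or_eq_neg_of_natAbs_valMinAbs_eq hr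
  · have h' : (-(k : ZMod n)).valMinAbs.natAbs = k := by rw [ZMod.natAbs_valMinAbs_neg, h]
    rintro (rfl | rfl)
    · exact ⟨h0 _ h, h⟩
    · exact ⟨h0 _ h', h'⟩

theorem coeff_cyclicSeries {n k : ℕ} (hk : k ≠ 0) (h : (k : ZMod n).valMinAbs.natAbs = k) :
    PowerSeries.coeff k (cyclicSeries n) = if n = 2 * k then 1 else 2 := by
  rw [cyclicSeries, countSeries, PowerSeries.coeff_mk, setOf_natAbs_valMinAbs_eq hk h]
  have h1 : (k : ZMod n) = -(k : ZMod n) ↔ n = 2 * k := by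
    rw [eq_neg_iff_add_eq_zero, ← Nat.cast_add, ZMod.natCast_eq_zero_iff, ← two_mul]
    refine ⟨fun hd => ?_, fun hd => hd ▸ dvd_refl _⟩
    rcases Nat.eq_zero_or_pos n with rfl | hn
    · exact (zero_dvd_iff.1 hd).symm
    · have : NeZero n := ⟨hn.ne'⟩
      have h2 := ZMod.natAbs_valMinAbs_le (k : ZMod n)
      rw [h] at h2
      have h3 := Nat.le_of_dvd (by omega) hd
      omega
  split_ifs with hn
  · rw [← h1.2 hn, Set.pair_eq_singleton, Set.ncard_singleton, Nat.cast_one]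
  · rw [Set.ncard_pair (mt h1.1 hn)]
    norm_num

theorem coeff_cyclicSeries_of_lt {n k : ℕ} (hn : n ≠ 0) (h : n / 2 < k) :
    PowerSeries.coeff k (cyclicSeries n) = 0 := by
  have : NeZero n := ⟨hn⟩
  rw [cyclicSeries, countSeries, PowerSeries.coeff_mk]
  have : {r : ZMod n | r ∈ {r : ZMod n | r ≠ 0} ∧ r.valMinAbs.natAbs = k} = ∅ := by
    ext r
    constructor
    · rintro ⟨-, h0⟩
      have := ZMod.natAbs_valMinAbs_le r
      omega
    · exact fun h => h.elim
  rw [this, Set.ncard_empty, Nat.cast_zero]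

theorem cyclicSeries_zero :
    cyclicSeries 0 = 2 * PowerSeries.X * (1 - PowerSeries.X)⁻¹ := by
  have h : (1 - PowerSeries.X : PowerSeries ℚ)⁻¹ = PowerSeries.mk 1 := by
    symm
    rw [PowerSeries.eq_inv_iff_mul_eq_one (by simp)]
    exact PowerSeries.mk_one_mul_one_sub_eq_one ℚ
  rw [h]
  ext k
  rw [mul_assoc, show (2 : PowerSeries ℚ) = PowerSeries.C 2 from rfl, PowerSeries.coeff_C_mul]
  rcases k with _ | k
  · rw [coeff_cyclicSeries_zero, PowerSeries.coeff_zero_X_mul, mul_zero]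
  · rw [PowerSeries.coeff_succ_X_mul, coeff_cyclicSeries (Nat.succ_ne_zero k) (by rfl),
      if_neg (by omega)]
    simp

theorem cyclicSeries_of_even {n : ℕ} (hn : n ≠ 0) (he : Even n) :
    cyclicSeries n = ∑ i ∈ Finset.Ico 1 (n / 2), 2 * PowerSeries.X ^ i +
      PowerSeries.X ^ (n / 2) := by
  ext k
  rw [map_add, map_sum, PowerSeries.coeff_X_pow]
  simp only [show (2 : PowerSeries ℚ) = PowerSeries.C 2 from rfl, PowerSeries.coeff_C_mul,
    PowerSeries.coeff_X_pow, mul_ite, mul_one, mul_zero, Finset.sum_ite_eq, Finset.mem_Ico]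
  obtain ⟨r, rfl⟩ := he
  rcases Nat.eq_zero_or_pos k with rfl | hk
  · rw [coeff_cyclicSeries_zero, if_neg (by omega), if_neg (by omega), add_zero]
  rcases lt_or_ge ((r + r) / 2) k with h | h
  · rw [coeff_cyclicSeries_of_lt hn h, if_neg (by omega), if_neg (by omega), add_zero]
  · rw [coeff_cyclicSeries hk.ne' (by rw [ZMod.valMinAbs_natCast_of_le_half h]; rfl)]
    by_cases h1 : k = r
    · rw [if_pos (by omega), if_neg (by omega), if_pos (by omega), zero_add]
    · rw [if_neg (by omega), if_pos (by omega), if_neg (by omega), add_zero]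

theorem cyclicSeries_of_not_even {n : ℕ} (he : ¬ Even n) :
    cyclicSeries n = ∑ i ∈ Finset.Icc 1 (n / 2), 2 * PowerSeries.X ^ i := by
  have hn : n ≠ 0 := by rintro rfl; simp at he
  ext k
  rw [map_sum]
  simp only [show (2 : PowerSeries ℚ) = PowerSeries.C 2 from rfl, PowerSeries.coeff_C_mul,
    PowerSeries.coeff_X_pow, mul_ite, mul_one, mul_zero, Finset.sum_ite_eq, Finset.mem_Icc]
  obtain ⟨r, rfl⟩ := Nat.not_even_iff_odd.1 he
  rcases Nat.eq_zero_or_pos k with rfl | hk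
  · rw [coeff_cyclicSeries_zero, if_neg (by omega)]
  rcases lt_or_ge ((2 * r + 1) / 2) k with h | h
  · rw [coeff_cyclicSeries_of_lt hn h, if_neg (by omega)]
  · rw [coeff_cyclicSeries hk.ne' (by rw [ZMod.valMinAbs_natCast_of_le_half h]; rfl),
      if_neg (by omega), if_pos (by omega)]

namespace DyerGraph

variable {V : Type*} (Δ : DyerGraph V)

theorem cyclicSeries_ord_of_mem_Vp {x : V} (hx : x ∈ Δ.Vp) : cyclicSeries (Δ.ord x) = Δ.Px x := by
  have h0 : Δ.ord x ≠ 0 := by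
    rw [ne_eq, ord_eq_zero_iff]
    exact hx.2.ne
  rw [Px]
  change _ = if Even (Δ.ord x) then _ else _
  split_ifs with h
  · exact cyclicSeries_of_even h0 h
  · exact cyclicSeries_of_not_even h

theorem cyclicSeries_ord_of_mem_Vinf {x : V} (hx : x ∈ Δ.Vinf) :
    cyclicSeries (Δ.ord x) = 2 * PowerSeries.X * (1 - PowerSeries.X)⁻¹ := by
  rw [(Δ.ord_eq_zero_iff).2 hx, cyclicSeries_zero]

/-! ### Growth series of a Dyer group -/

theorem growthSeriesOn_gens (A : Set Δ.DyerGroup) :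
    growthSeriesOn Δ.gens A = countSeries A Δ.wordNorm := by
  simp only [growthSeriesOn, countSeries, wordLength_gens]

theorem finite_setOf_wordNorm_eq [Finite V] (A : Set Δ.DyerGroup) (n : ℕ) :
    {g | g ∈ A ∧ Δ.wordNorm g = n}.Finite :=
  (Δ.finite_setOf_wordNorm_le n).subset fun _ hg => hg.2.le

theorem growthSeries_eq_mul [Finite V] (Y : Set V) :
    growthSeries Δ.gens = growthSeriesOn Δ.gens (Δ.A Y) * growthSeries (Δ.parabolicGens Y) := by
  have h1 : growthSeries (Δ.parabolicGens Y) =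
      countSeries Set.univ fun g : Δ.parabolic Y => Δ.wordNorm g := by
    simp only [growthSeries, growthSeriesOn, countSeries, wordLength_parabolicGens]
  rw [growthSeries, growthSeriesOn_gens, growthSeriesOn_gens, h1]
  refine countSeries_mul (fun a h => a * h) ⟨?_, ?_, ?_⟩ ?_ (Δ.finite_setOf_wordNorm_eq _) ?_
  · exact fun _ _ => trivial
  · rintro ⟨a, h⟩ ⟨ha, -⟩ ⟨a', h'⟩ ⟨ha', -⟩ he
    obtain ⟨rfl, h2⟩ := Δ.eq_of_isMinimal_mul_eq ha ha' h.2 h'.2 he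
    rw [Subtype.ext h2]
  · intro g _
    obtain ⟨a, h, ha, hh, rfl⟩ := Δ.exists_isMinimal_mul Y g
    exact ⟨(a, ⟨h, hh⟩), ⟨ha, trivial⟩, rfl⟩
  · intro a ha h _
    exact Δ.norm_mul_of_isMinimal absSum_zero ha h.2
  · intro n
    exact ((Δ.finite_setOf_wordNorm_eq Set.univ n).preimage
      Subtype.val_injective.injOn).subset fun g hg => ⟨trivial, hg.2⟩

theorem growthSeriesOn_A_univ : growthSeriesOn Δ.gens (Δ.A Set.univ) = 1 := by
  have h : Δ.A Set.univ = {1} := by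
    ext g
    constructor
    · intro hg
      have := (Δ.isMinimal_iff).1 hg g⁻¹ (by rw [parabolic_univ]; trivial)
      rw [mul_inv_cancel, sylNorm, sylNorm, Δ.norm_one indicator_zero] at this
      exact Δ.eq_one_of_sylNorm_eq_zero (Nat.le_zero.1 this)
    · rintro rfl
      refine (Δ.isMinimal_iff).2 fun h _ => ?_
      rw [sylNorm, Δ.norm_one indicator_zero]
      exact Nat.zero_le _
  rw [h, growthSeriesOn_gens, countSeries_singleton, wordNorm, Δ.norm_one absSum_zero, pow_zero]

theorem constantCoeff_growthSeries_ne_zero [Finite V] :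
    PowerSeries.constantCoeff (growthSeries Δ.gens) ≠ 0 := by
  rw [growthSeries, growthSeriesOn_gens, ← PowerSeries.coeff_zero_eq_constantCoeff_apply,
    countSeries, PowerSeries.coeff_mk, Nat.cast_ne_zero]
  exact Set.ncard_ne_zero_of_mem (a := 1) ⟨trivial, Δ.norm_one absSum_zero⟩
    (Δ.finite_setOf_wordNorm_eq _ 0)

/-- Inclusion-exclusion for the sets `A_Y`: the element `g` contributes the alternating sum over
the subsets of the set of its nondescents. -/
theorem sum_neg_one_pow_mul_growthSeriesOn_A [Fintype V] :
    ∑ Y : Finset V, (-1) ^ Y.card * growthSeriesOn Δ.gens (Δ.A (Y : Set V)) =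
      growthSeriesOn Δ.gens (Δ.B ∅) := by
  classical
  ext n
  let F : Finset Δ.DyerGroup := (Δ.finite_setOf_wordNorm_eq Set.univ n).toFinset
  have hF : ∀ g, g ∈ F ↔ Δ.wordNorm g = n := by simp [F]
  have hcoeff : ∀ A : Set Δ.DyerGroup, PowerSeries.coeff n (growthSeriesOn Δ.gens A) =
      ∑ g ∈ F, if g ∈ A then 1 else 0 := by
    intro A
    rw [growthSeriesOn_gens, countSeries, PowerSeries.coeff_mk, Finset.sum_boole]
    rw [← Set.ncard_coe_finset]
    congr 2
    ext g
    simp [hF, and_comm]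
  let N : Δ.DyerGroup → Finset V := fun g =>
    Finset.univ.filter fun x => Δ.inversion g (Δ.gen x) = 0
  have hA : ∀ (Y : Finset V) g, g ∈ Δ.A (Y : Set V) ↔ Y ∈ (N g).powerset := by
    intro Y g
    rw [A, Set.mem_ofPred_eq, isMinimal_iff_forall, Finset.mem_powerset]
    simp [N, Finset.subset_iff]
  have hB : ∀ g, g ∈ Δ.B ∅ ↔ N g = ∅ := by
    intro g
    rw [mem_B_empty_iff]
    simp [N, Finset.filter_eq_empty_iff]
  rw [map_sum, hcoeff]
  have hsign : ∀ Y : Finset V, PowerSeries.coeff n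
      ((-1) ^ Y.card * growthSeriesOn Δ.gens (Δ.A (Y : Set V))) =
      ∑ g ∈ F, if Y ∈ (N g).powerset then (-1) ^ Y.card else 0 := by
    intro Y
    have : ((-1) ^ Y.card : PowerSeries ℚ) = PowerSeries.C ((-1) ^ Y.card) := by simp
    rw [this, PowerSeries.coeff_C_mul, hcoeff, Finset.mul_sum]
    refine Finset.sum_congr rfl fun g _ => ?_
    rw [if_congr (hA Y g) rfl rfl, mul_ite, mul_one, mul_zero]
  rw [Finset.sum_congr rfl fun Y _ => hsign Y, Finset.sum_comm]
  refine Finset.sum_congr rfl fun g _ => ?_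
  rw [Finset.sum_ite_mem, Finset.univ_inter, if_congr (hB g) rfl rfl]
  have := Finset.sum_powerset_neg_one_pow_card (x := N g)
  have h2 := congrArg (Int.cast : ℤ → ℚ) this
  push_cast at h2
  rw [h2]

/-- The common form of both identities; the term of `Y = V` is moved to the right-hand side. -/
theorem sum_ssubsets_eq [Fintype V] [DecidableEq V] :
    ∑ Y ∈ (Finset.univ : Finset V).ssubsets,
        (-1) ^ Y.card * (growthSeries (Δ.parabolicGens (Y : Set V)))⁻¹ =
      (growthSeriesOn Δ.gens (Δ.B ∅) + (-1) ^ (Fintype.card V + 1)) *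
        (growthSeries Δ.gens)⁻¹ := by
  set G := growthSeries Δ.gens
  have hG : PowerSeries.constantCoeff G ≠ 0 := Δ.constantCoeff_growthSeries_ne_zero
  have hinv : ∀ Y : Set V, (growthSeries (Δ.parabolicGens Y))⁻¹ =
      growthSeriesOn Δ.gens (Δ.A Y) * G⁻¹ := by
    intro Y
    have h1 := Δ.growthSeries_eq_mul Y
    have h2 : PowerSeries.constantCoeff (growthSeries (Δ.parabolicGens Y)) ≠ 0 := by
      intro h0
      apply hG
      change PowerSeries.constantCoeff (growthSeries Δ.gens) = 0
      rw [h1, map_mul, h0, mul_zero]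
    symm
    rw [PowerSeries.eq_inv_iff_mul_eq_one h2, mul_right_comm, ← h1]
    exact PowerSeries.mul_inv_cancel _ hG
  have h3 : ∑ Y : Finset V, (-1) ^ Y.card * (growthSeries (Δ.parabolicGens (Y : Set V)))⁻¹ =
      growthSeriesOn Δ.gens (Δ.B ∅) * G⁻¹ := by
    rw [← sum_neg_one_pow_mul_growthSeriesOn_A, Finset.sum_mul]
    refine Finset.sum_congr rfl fun Y _ => ?_
    rw [hinv, mul_assoc]
  have h4 := Finset.sum_erase_add Finset.univ (fun Y : Finset V =>
    (-1) ^ Y.card * (growthSeries (Δ.parabolicGens (Y : Set V)))⁻¹)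
    (Finset.mem_univ (Finset.univ : Finset V))
  have h5 : (growthSeries (Δ.parabolicGens ((Finset.univ : Finset V) : Set V)))⁻¹ = G⁻¹ := by
    rw [hinv, Finset.coe_univ, growthSeriesOn_A_univ, one_mul]
  rw [h3, h5, Finset.card_univ] at h4
  rw [Finset.ssubsets, Finset.powerset_univ, pow_succ]
  linear_combination h4

/-- The elements `w * ∏ x ^ c x` with nontrivial factors `x ^ c x`, for `x` in the list `L`. -/
def powProdSet (w : Δ.DyerGroup) (L : List V) : Set Δ.DyerGroup :=
  {g | ∃ c : V → ℤ, (∀ x ∈ L, ¬ (Δ.ord x : ℤ) ∣ c x) ∧ g = w * Δ.powProd L c}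

theorem countSeries_powProdSet [Finite V] (hG : Δ.graph = ⊤) {w : Δ.DyerGroup}
    (hw : w ∈ Δ.parabolic Δ.V2) {L : List V} (hL : L.Nodup) (hmem : ∀ x ∈ L, x ∉ Δ.V2) :
    countSeries (Δ.powProdSet w L) Δ.wordNorm =
      PowerSeries.X ^ Δ.wordNorm w * (L.map fun x => cyclicSeries (Δ.ord x)).prod := by
  classical
  induction L with
  | nil =>
    have : Δ.powProdSet w [] = {w} := by ext g; simp [powProdSet]
    rw [this, countSeries_singleton]
    simp
  | cons x L ih =>
    obtain ⟨hxL, hL⟩ := List.nodup_cons.1 hL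
    have hx := hmem x (List.mem_cons_self ..)
    have hmem' := fun y hy => hmem y (List.mem_cons_of_mem _ hy)
    have ih := ih hL hmem'
    have hpar : ∀ g ∈ Δ.powProdSet w L, g ∈ Δ.parabolic {x}ᶜ := by
      rintro _ ⟨c, -, rfl⟩
      refine mul_mem (Δ.parabolic_mono ?_ hw) (Δ.powProd_mem_parabolic fun y hy => Or.inl ?_)
      · rintro y hy rfl
        exact hx hy
      · rintro rfl
        exact hxL hy
    have hmin : ∀ g ∈ Δ.powProdSet w L, Δ.IsMinimal {x} g := fun g hg =>
      (Δ.isMinimal_singleton_iff).2 (Δ.inversion_gen_eq_zero_of_notMem (hpar g hg) hx (by simp))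
    have hcons : ∀ c : V → ℤ, w * Δ.powProd (x :: L) c = w * Δ.powProd L c * Δ.gen x ^ c x := by
      intro c
      rw [powProd_cons, ((Δ.commute_gen_of_eq_top hG hx _).zpow_left _).eq, mul_assoc]
    have hzpow : ∀ k : ℤ, Δ.gen x ^ k ∈ Δ.parabolic {x} := fun k =>
      Subgroup.zpow_mem _ (Δ.gen_mem_parabolic (Set.mem_singleton x)) k
    rw [List.map_cons, List.prod_cons, mul_left_comm, ← ih, mul_comm]
    -- The factorization is the one into an `{x}`-minimal element and an element of `D_{x}`.
    refine countSeries_mul (fun g r => g * Δ.gen x ^ r.valMinAbs) ⟨?_, ?_, ?_⟩ ?_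
      (Δ.finite_setOf_wordNorm_eq _) fun n => finite_setOf_natAbs_valMinAbs _ _ _
    · rintro ⟨_, r⟩ ⟨⟨c, hc, rfl⟩, hr⟩
      refine ⟨Function.update c x r.valMinAbs, ?_, ?_⟩
      · intro y hy
        by_cases hyx : y = x
        · subst hyx
          rw [Function.update_self, ← ZMod.intCast_zmod_eq_zero_iff_dvd, ZMod.coe_valMinAbs]
          exact hr
        · rw [Function.update_of_ne hyx]
          exact hc y ((List.mem_cons.1 hy).resolve_left hyx)
      · rw [hcons, Function.update_self]
        have : Δ.powProd L (Function.update c x r.valMinAbs) = Δ.powProd L c :=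
          Δ.powProd_congr fun y hy => Function.update_of_ne (by rintro rfl; exact hxL hy) _ _
        rw [this]
    · rintro ⟨g, r⟩ ⟨hg, -⟩ ⟨g', r'⟩ ⟨hg', -⟩ he
      obtain ⟨rfl, h2⟩ := Δ.eq_of_isMinimal_mul_eq (hmin g hg) (hmin g' hg') (hzpow _) (hzpow _) he
      have h3 := congrArg (Δ.exponent x hx) h2
      rw [map_zpow, map_zpow, exponent_gen_self, ← ofAdd_zsmul, ← ofAdd_zsmul] at h3
      have h4 := Multiplicative.ofAdd.injective h3
      simp only [zsmul_eq_mul, mul_one, ZMod.coe_valMinAbs] at h4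
      rw [h4]
    · rintro _ ⟨c, hc, rfl⟩
      refine ⟨(w * Δ.powProd L c, (c x : ZMod (Δ.ord x))), ⟨⟨c, ?_, rfl⟩, ?_⟩, ?_⟩
      · exact fun y hy => hc y (List.mem_cons_of_mem _ hy)
      · change (c x : ZMod (Δ.ord x)) ≠ 0
        rw [ne_eq, ZMod.intCast_zmod_eq_zero_iff_dvd]
        exact hc x (List.mem_cons_self ..)
      · rw [hcons]
        exact congrArg _ (Δ.gen_zpow_congr (ZMod.coe_valMinAbs _))
    · intro g hg r _
      rw [wordNorm, Δ.norm_mul_of_isMinimal absSum_zero (hmin g hg) (hzpow _),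
        Δ.norm_gen_zpow absSum_zero, absSum_zsmul_theta, ZMod.coe_valMinAbs]
      rfl

theorem notMem_V2_iff (x : V) : x ∉ Δ.V2 ↔ x ∈ Δ.Vp ∨ x ∈ Δ.Vinf := by
  have h := Δ.two_le_f x
  simp only [V2, Vp, Vinf, Set.mem_ofPred_eq]
  constructor
  · intro hx
    by_cases ht : Δ.f x = ⊤
    · exact Or.inr ht
    · exact Or.inl ⟨lt_of_le_of_ne h (Ne.symm hx), lt_top_iff_ne_top.2 ht⟩
  · rintro (⟨h1, -⟩ | h1) h2
    · exact h1.ne' h2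
    · rw [h1] at h2
      exact absurd h2 (by simp)

/-- In spherical type `B_∅` is the product of the longest element of `D_2` with the nontrivial
elements of the cyclic factors. -/
theorem growthSeriesOn_B_empty [Fintype V] (h : Δ.IsSpherical) :
    growthSeriesOn Δ.gens (Δ.B ∅) = Δ.PD := by
  classical
  obtain ⟨hG, hfin⟩ := h
  obtain ⟨w, hw, hlen, huniq⟩ := Δ.exists_longest hfin
  set xs := (Finset.univ.filter fun x => x ∈ Δ.Vp).toList
  set ys := (Finset.univ.filter fun x => x ∈ Δ.Vinf).toList
  have hmem : ∀ x, x ∈ xs ++ ys ↔ x ∉ Δ.V2 := by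
    intro x
    rw [notMem_V2_iff]
    simp [xs, ys]
  have hnd : (xs ++ ys).Nodup := by
    refine (Finset.nodup_toList _).append (Finset.nodup_toList _) fun x hx hy => ?_
    have h1 : x ∈ Δ.Vp := by simpa [xs] using hx
    have h2 : x ∈ Δ.Vinf := by simpa [ys] using hy
    exact h1.2.ne h2
  have hB : Δ.B ∅ = Δ.powProdSet w (xs ++ ys) := by
    ext g
    rw [Δ.mem_B_empty_iff_exists hG hnd hmem]
    constructor
    · rintro ⟨u, hu, c, h1, h2, rfl⟩
      rw [(huniq u hu).1 h1]
      exact ⟨c, h2, rfl⟩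
    · rintro ⟨c, h2, rfl⟩
      exact ⟨w, hw, c, (huniq w hw).2 rfl, h2, rfl⟩
  rw [growthSeriesOn_gens, hB, Δ.countSeries_powProdSet hG hw hnd fun x hx => (hmem x).1 hx, hlen,
    PD, List.map_append, List.prod_append, mul_assoc]
  congr 2
  · rw [Finset.prod_map_toList]
    exact Finset.prod_congr rfl fun x hx =>
      Δ.cyclicSeries_ord_of_mem_Vp (by simpa using hx)
  · rw [Finset.prod_map_toList, Finset.prod_congr rfl fun x hx =>
      Δ.cyclicSeries_ord_of_mem_Vinf (by simpa using hx), Finset.prod_const]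
    congr 1
    rw [← Set.ncard_coe_finset]
    simp

end DyerGraph

namespace DyerGraph

/-- The explicit form of the elements of `B_∅` in spherical type, for given enumerations of `V_p`
and `V_∞`. -/
theorem mem_B_empty_iff_of_isSpherical {V : Type*} (Δ : DyerGraph V) (h : Δ.IsSpherical)
    {xs ys : List V} (hxs : xs.Nodup) (hxs' : ∀ x, x ∈ xs ↔ x ∈ Δ.Vp) (hys : ys.Nodup)
    (hys' : ∀ y, y ∈ ys ↔ y ∈ Δ.Vinf) (g : Δ.DyerGroup) :
    g ∈ Δ.B ∅ ↔ ∃ (w₀ : Δ.parabolic Δ.V2) (a b : V → ℤ),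
      IsLongestElement (Δ.parabolicGens Δ.V2) w₀ ∧
      (∀ x ∈ xs, ¬ (((Δ.f x).toNat : ℤ) ∣ a x)) ∧ (∀ y ∈ ys, b y ≠ 0) ∧
      g = (w₀ : Δ.DyerGroup) * Δ.powProd xs a * Δ.powProd ys b := by
  classical
  have hord : ∀ y ∈ ys, ∀ k : ℤ, ¬ (Δ.ord y : ℤ) ∣ k ↔ k ≠ 0 := by
    intro y hy k
    rw [(Δ.ord_eq_zero_iff).2 ((hys' y).1 hy), Nat.cast_zero, zero_dvd_iff]
  have hdisj : ∀ x ∈ xs, ∀ y ∈ ys, x ≠ y := by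
    rintro x hx _ hy rfl
    exact ((hxs' x).1 hx).2.ne ((hys' x).1 hy)
  have hnd : (xs ++ ys).Nodup := hxs.append hys fun x hx hy => hdisj x hx x hy rfl
  have hmem : ∀ x, x ∈ xs ++ ys ↔ x ∉ Δ.V2 := by
    intro x
    rw [notMem_V2_iff, List.mem_append, hxs', hys']
  rw [Δ.mem_B_empty_iff_exists h.1 hnd hmem]
  constructor
  · rintro ⟨w, hw, c, h1, h2, rfl⟩
    refine ⟨⟨w, hw⟩, c, c, (Δ.isLongestElement_iff _).2 h1,
      fun x hx => h2 x (List.mem_append_left _ hx),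
      fun y hy => (hord y hy _).1 (h2 y (List.mem_append_right _ hy)), ?_⟩
    rw [powProd_append, mul_assoc]
  · rintro ⟨w, a, b, h1, h2, h3, rfl⟩
    have ha : ∀ x ∈ xs, (if x ∈ xs then a x else b x) = a x := fun x hx => if_pos hx
    have hb : ∀ y ∈ ys, (if y ∈ xs then a y else b y) = b y := fun y hy =>
      if_neg fun hx => hdisj y hx y hy rfl
    refine ⟨w, w.2, fun x => if x ∈ xs then a x else b x, (Δ.isLongestElement_iff w).1 h1, ?_, ?_⟩
    · intro x hx
      rcases List.mem_append.1 hx with hx | hx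
      · change ¬ _ ∣ (if x ∈ xs then a x else b x)
        rw [ha x hx]
        exact h2 x hx
      · change ¬ _ ∣ (if x ∈ xs then a x else b x)
        rw [hb x hx, hord x hx]
        exact h3 x hx
    · rw [powProd_append, Δ.powProd_congr ha, Δ.powProd_congr hb, mul_assoc]

end DyerGraph

theorem corollary4p8 {V : Type*} [Fintype V] [DecidableEq V] (Δ : DyerGraph V) :
    -- non-spherical type
    (¬ Δ.IsSpherical →
      (-1) ^ (Fintype.card V + 1) * (growthSeries Δ.gens)⁻¹ =
        ∑ Y ∈ (Finset.univ : Finset V).ssubsets,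
          (-1) ^ Y.card * (growthSeries (Δ.parabolicGens (Y : Set V)))⁻¹) ∧
    -- spherical type
    (Δ.IsSpherical →
      (Δ.PD + (-1) ^ (Fintype.card V + 1)) * (growthSeries Δ.gens)⁻¹ =
        ∑ Y ∈ (Finset.univ : Finset V).ssubsets,
          (-1) ^ Y.card * (growthSeries (Δ.parabolicGens (Y : Set V)))⁻¹ ∧
      growthSeriesOn Δ.gens (Δ.B ∅) = Δ.PD ∧
      -- for any enumerations `xs` of `V_p` and `ys` of `V_∞`
      ∀ xs ys : List V, xs.Nodup → (∀ x, x ∈ xs ↔ x ∈ Δ.Vp) →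
        ys.Nodup → (∀ y, y ∈ ys ↔ y ∈ Δ.Vinf) →
        ∀ g : Δ.DyerGroup, g ∈ Δ.B ∅ ↔
          ∃ (w₀ : Δ.parabolic Δ.V2) (a b : V → ℤ),
            IsLongestElement (Δ.parabolicGens Δ.V2) w₀ ∧
            (∀ x ∈ xs, ¬ (((Δ.f x).toNat : ℤ) ∣ a x)) ∧
            (∀ y ∈ ys, b y ≠ 0) ∧
            g = (w₀ : Δ.DyerGroup) * (xs.map fun x => Δ.gen x ^ a x).prod *
              (ys.map fun y => Δ.gen y ^ b y).prod) := by
  rw [Δ.sum_ssubsets_eq]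
  refine ⟨fun h => ?_, fun h => ⟨?_, Δ.growthSeriesOn_B_empty h,
    fun xs ys hxs hxs' hys hys' g => Δ.mem_B_empty_iff_of_isSpherical h hxs hxs' hys hys' g⟩⟩
  · have hB : Δ.B ∅ = ∅ :=
      Set.eq_empty_of_forall_notMem fun g hg => h (Δ.isSpherical_of_mem_B hg)
    have h0 : growthSeriesOn Δ.gens (∅ : Set Δ.DyerGroup) = 0 := by
      ext n
      simp [growthSeriesOn]
    rw [hB, h0, zero_add]
  · rw [Δ.growthSeriesOn_B_empty h]
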